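/- Let $V:\mathbb{R}^\nu\to\mathbb{R}$ be bounded and $C^1$, let $H=-\tfrac12\Delta+V$ on $L^2(\mathbb{R}^\nu)$ (with domain $\{f\in L^2:\Delta f\in L^2\}$), and let $K_t(x,y)$, $t>0$, be the (continuous) integral kernel of $e^{-tH}$. For bounded measurable $f$ put $(e^{-tH}f)(x)=\int K_t(x,y)f(y)\,d^\nu y$. Suppose that there are a measurable function $\Omega$ on $\mathbb{R}^\nu$ and constants $a,b$ with $0<a\le\Omega(x)\le b$ for all $x$ and $e^{-tH}\Omega=\Omega$ for all $t>0$. Let $$L_t(x,y)=\Omega(x)^{-1}K_t(x,y)\,\Omega(y)^{-1},$$ which is the integral kernel, with respect to $\Omega^2\,d^\nu x$, of the intrinsic semigroup $Ue^{-tH}U^{-1}$ on $L^2(\mathbb{R}^\nu,\Omega^2\,d^\nu x)$, where $Uf=\Omega^{-1}f$ is unitary from $L^2(\mathbb{R}^\nu)$ onto $L^2(\mathbb{R}^\nu,\Omega^2\,d^\nu x)$. Call a continuous vector field $u^{(0)}=(u^{(0)}_1,\dots,u^{(0)}_\nu)$ on $\mathbb{R}^\nu$ admissible if $\partial u^{(0)}_i/\partial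 x_j=\partial u^{(0)}_j/\partial x_i$ for all $i,j$ (in the sense of distributions) and $\psi_0(x)=\int_0^x u^{(0)}(y)\cdot dy$ is bounded, where the line integral is taken along the segment from $0$ to $x$; put $\varphi_0=e^{-\psi_0}$ and $\varphi(x,t)=(e^{-tH}\varphi_0)(x)$. **Proposition 2.2.** If $$\sup_{x}\int|\partial_xL_t(x,y)|\,d^\nu y\to0\qquad(t\to\infty),$$ where $\partial_x$ denotes the gradient in $x$, then for every admissible $u^{(0)}$ the function $\varphi(\cdot,t)/\Omega$ is differentiable for every $t>0$, and $$\lim_{t\to\infty}\ \sup_{x}\bigl|\nabla\bigl(\varphi(\cdot,t)/\Omega\bigr)(x)\bigr|=0 .$$ -/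

import Mathlib

open MeasureTheory Filter Topology Set
open scoped SchwartzMap ENNReal ContDiff Laplacian

noncomputable section

/-- Euclidean space `ℝ^ν`. -/
abbrev Eucl (ν : ℕ) : Type := EuclideanSpace ℝ (Fin ν)

/-- The Hilbert space `L²(ℝ^ν)` of real functions, for Lebesgue measure. -/
abbrev L2 (ν : ℕ) : Type := Lp ℝ 2 (volume : Measure (Eucl ν))

/-! ### The Schrödinger operator `H = -½ Δ + V` on `L²` -/

theorem integrable_L2_mul_schwartz {ν : ℕ} (f : L2 ν) (ψ : 𝓢(Eucl ν, ℝ)) :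
    Integrable (fun x => f x * ψ x) := by
  have h := (Lp.memLp f).integrable_mul (SchwartzMap.memLp ψ 2 (volume : Measure (Eucl ν)))
  exact h

/-- The graph of the Laplacian on `L²`: the pairs `(f, g)` with `g = Δ f` in the sense of
distributions. -/
def laplacianGraph (ν : ℕ) : Submodule ℝ (L2 ν × L2 ν) where
  carrier := {p | ∀ ψ : 𝓢(Eucl ν, ℝ), ∫ x, p.2 x * ψ x = ∫ x, p.1 x * (Δ ψ) x}
  zero_mem' := by
    intro ψ
    have h : ∀ χ : 𝓢(Eucl ν, ℝ), ∫ x, (0 : L2 ν) x * χ x = 0 := by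
      intro χ
      apply integral_eq_zero_of_ae
      filter_upwards [Lp.coeFn_zero ℝ 2 (volume : Measure (Eucl ν))] with x hx
      rw [hx]
      simp
    exact (h ψ).trans (h (Δ ψ)).symm
  add_mem' := by
    intro p q hp hq ψ
    have h : ∀ (f g : L2 ν) (χ : 𝓢(Eucl ν, ℝ)),
        ∫ x, (f + g) x * χ x = (∫ x, f x * χ x) + ∫ x, g x * χ x := by
      intro f g χ
      rw [← integral_add (integrable_L2_mul_schwartz f χ) (integrable_L2_mul_schwartz g χ)]
      apply integral_congr_ae
      filter_upwards [Lp.coeFn_add f g] with x hx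
      rw [hx, Pi.add_apply, add_mul]
    exact (h p.2 q.2 ψ).trans ((congrArg₂ (· + ·) (hp ψ) (hq ψ)).trans (h p.1 q.1 (Δ ψ)).symm)
  smul_mem' := by
    intro c p hp ψ
    have h : ∀ (f : L2 ν) (χ : 𝓢(Eucl ν, ℝ)),
        ∫ x, (c • f) x * χ x = c * ∫ x, f x * χ x := by
      intro f χ
      rw [← integral_const_mul]
      apply integral_congr_ae
      filter_upwards [Lp.coeFn_smul c f] with x hx
      rw [hx, Pi.smul_apply, smul_eq_mul, mul_assoc]
    exact (h p.2 ψ).trans ((congrArg (c * ·) (hp ψ)).trans (h p.1 (Δ ψ)).symm)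

/-- The distributional Laplacian of a function is unique. -/
theorem laplacianGraph_functional {ν : ℕ} (p : L2 ν × L2 ν) (hp : p ∈ laplacianGraph ν)
    (h0 : p.1 = 0) : p.2 = 0 := by
  have key : ∀ ψ : 𝓢(Eucl ν, ℝ), ∫ x, p.2 x * ψ x = 0 := by
    intro ψ
    rw [hp ψ]
    apply integral_eq_zero_of_ae
    filter_upwards [Lp.coeFn_zero ℝ 2 (volume : Measure (Eucl ν))] with x hx
    rw [h0, hx]
    simp
  apply (Lp.eq_zero_iff_ae_eq_zero).2
  apply ae_eq_zero_of_integral_contDiff_smul_eq_zero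
  · exact (Lp.memLp p.2).locallyIntegrable (by norm_num)
  · intro g hg hgc
    have h := key (hgc.toSchwartzMap hg)
    rw [← h]
    apply integral_congr_ae
    filter_upwards with x
    simp [mul_comm]

/-- The Laplacian as an unbounded operator on `L²(ℝ^ν)`: its domain consists of all `f ∈ L²` whose
distributional Laplacian lies in `L²` (the Sobolev space `H²`). -/
def laplacianL2 (ν : ℕ) : L2 ν →ₗ.[ℝ] L2 ν := (laplacianGraph ν).toLinearPMap

/-- The graph of `laplacianL2` is what it should be. -/
theorem laplacianL2_graph (ν : ℕ) : (laplacianL2 ν).graph = laplacianGraph ν :=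
  Submodule.toLinearPMap_graph_eq _ laplacianGraph_functional

theorem mul_add_ae {ν : ℕ} (V : Eucl ν → ℝ) (f g : L2 ν) :
    (fun x => V x * (f + g : L2 ν) x) =ᵐ[volume] (fun x => V x * f x) + fun x => V x * g x := by
  filter_upwards [Lp.coeFn_add f g] with x hx
  rw [hx, Pi.add_apply, Pi.add_apply, mul_add]

theorem mul_smul_ae {ν : ℕ} (V : Eucl ν → ℝ) (c : ℝ) (f : L2 ν) :
    (fun x => V x * (c • f : L2 ν) x) =ᵐ[volume] c • fun x => V x * f x := by
  filter_upwards [Lp.coeFn_smul c f] with x hx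
  rw [hx, Pi.smul_apply, Pi.smul_apply, smul_eq_mul, smul_eq_mul]
  ring

/-- The maximal domain `{f ∈ L² | V f ∈ L²}` of multiplication by `V` (which is all of `L²` if `V`
is bounded and measurable). -/
def mulDomain {ν : ℕ} (V : Eucl ν → ℝ) : Submodule ℝ (L2 ν) where
  carrier := {f | MemLp (fun x => V x * f x) 2 volume}
  zero_mem' := by
    have h : (fun _ : Eucl ν => (0 : ℝ)) =ᵐ[volume] fun x => V x * (0 : L2 ν) x := by
      filter_upwards [Lp.coeFn_zero ℝ 2 (volume : Measure (Eucl ν))] with x hx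
      rw [hx]
      simp
    exact (memLp_congr_ae h).1 (MemLp.zero' : MemLp (fun _ : Eucl ν => (0 : ℝ)) 2 volume)
  add_mem' := fun {f g} hf hg => (memLp_congr_ae (mul_add_ae V f g)).2 (MemLp.add hf hg)
  smul_mem' := fun c f hf => (memLp_congr_ae (mul_smul_ae V c f)).2 (MemLp.const_smul hf c)

theorem memLp_of_mem_mulDomain {ν : ℕ} {V : Eucl ν → ℝ} (f : mulDomain V) :
    MemLp (fun x => V x * (f : L2 ν) x) 2 volume := f.2

/-- Multiplication by `V` as an operator on `L²`, on its maximal domain. -/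
def mulL2 {ν : ℕ} (V : Eucl ν → ℝ) : L2 ν →ₗ.[ℝ] L2 ν where
  domain := mulDomain V
  toFun :=
    { toFun := fun f => (memLp_of_mem_mulDomain f).toLp
      map_add' := fun f g =>
        (MemLp.toLp_congr (memLp_of_mem_mulDomain (f + g))
          ((memLp_of_mem_mulDomain f).add (memLp_of_mem_mulDomain g))
          (mul_add_ae V f g)).trans (MemLp.toLp_add _ _)
      map_smul' := fun c f =>
        (MemLp.toLp_congr (memLp_of_mem_mulDomain (c • f))
          ((memLp_of_mem_mulDomain f).const_smul c)
          (mul_smul_ae V c f)).trans (MemLp.toLp_const_smul c _) }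

/-- The Schrödinger operator `H = -½ Δ + V` on `L²(ℝ^ν)`. -/
def schrodinger {ν : ℕ} (V : Eucl ν → ℝ) : L2 ν →ₗ.[ℝ] L2 ν :=
  (-(1 / 2) : ℝ) • laplacianL2 ν + mulL2 V

/-! ### The semigroup `e^{-tH}` and its integral kernel -/

/-- `T` (restricted to `t ≥ 0`) is the strongly continuous one-parameter semigroup on `X` whose
infinitesimal generator is exactly the unbounded operator `A`. Such a semigroup is uniquely
determined by `A`. -/
structure IsSemigroupGeneratedBy {X : Type*} [NormedAddCommGroup X] [NormedSpace ℝ X]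
    (A : X →ₗ.[ℝ] X) (T : ℝ → X →L[ℝ] X) : Prop where
  zero : T 0 = ContinuousLinearMap.id ℝ X
  add : ∀ s t : ℝ, 0 ≤ s → 0 ≤ t → T (s + t) = (T s).comp (T t)
  continuousOn : ∀ f : X, ContinuousOn (fun t => T t f) (Ici 0)
  generator : ∀ f g : X,
    Tendsto (fun t : ℝ => t⁻¹ • (T t f - f)) (𝓝[>] 0) (𝓝 g) ↔ (f, g) ∈ A.graph

open scoped Classical in
/-- The strongly continuous semigroup `t ↦ e^{tA}`, `t ≥ 0`, generated by `A` (and `0` if `A` does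
not generate such a semigroup). -/
def expSemigroup {X : Type*} [NormedAddCommGroup X] [NormedSpace ℝ X]
    (A : X →ₗ.[ℝ] X) : ℝ → X →L[ℝ] X :=
  if h : ∃ T, IsSemigroupGeneratedBy A T then h.choose else 0

/-- `k` is a continuous integral kernel of the operator `S` on `L²(ℝ^ν)`. A continuous integral
kernel is uniquely determined by `S`. -/
structure IsIntegralKernel {ν : ℕ} (S : L2 ν →L[ℝ] L2 ν) (k : Eucl ν → Eucl ν → ℝ) : Prop where
  continuous : Continuous fun p : Eucl ν × Eucl ν => k p.1 p.2
  apply_ae_eq : ∀ f : L2 ν, S f =ᵐ[volume] fun x => ∫ y, k x y * f y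

open scoped Classical in
/-- The continuous integral kernel of `S` (and `0` if there is none). -/
def integralKernel {ν : ℕ} (S : L2 ν →L[ℝ] L2 ν) : Eucl ν → Eucl ν → ℝ :=
  if h : ∃ k, IsIntegralKernel S k then h.choose else 0

/-- `K_t(x, y)`, the integral kernel of `e^{-tH}`, for `t > 0`. -/
def heatKernel {ν : ℕ} (V : Eucl ν → ℝ) (t : ℝ) : Eucl ν → Eucl ν → ℝ :=
  integralKernel (expSemigroup (-schrodinger V) t)

/-- `(e^{-tH} f)(x) = ∫ K_t(x, y) f(y) dy`, for bounded `f` and `t > 0`. -/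
def heatFlow {ν : ℕ} (V : Eucl ν → ℝ) (f : Eucl ν → ℝ) (t : ℝ) (x : Eucl ν) : ℝ :=
  ∫ y, heatKernel V t x y * f y

/-- The kernel `L_t(x, y) = Ω(x)⁻¹ K_t(x, y) Ω(y)⁻¹` of the intrinsic semigroup
`U e^{-tH} U⁻¹` on `L²(ℝ^ν, Ω² dx)`, where `U f = Ω⁻¹ f`. -/
def intrinsicKernel {ν : ℕ} (V Ω : Eucl ν → ℝ) (t : ℝ) (x y : Eucl ν) : ℝ :=
  (Ω x)⁻¹ * heatKernel V t x y * (Ω y)⁻¹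

/-! ### Initial data -/

/-- `ψ₀(x) = ∫₀ˣ u⁰ · dy`, the line integral taken along the segment from `0` to `x`. -/
def linePotential {ν : ℕ} (u₀ : Eucl ν → Eucl ν) (x : Eucl ν) : ℝ :=
  ∫ s in (0 : ℝ)..1, inner ℝ (u₀ (s • x)) x

/-- Admissible initial data of the forced Burgers equation: continuous vector fields `u⁰` with
`∂_j u⁰_i = ∂_i u⁰_j` (in the sense of distributions, so that `C¹` fields with this property are
included) and with bounded `ψ₀`. -/
structure IsAdmissible {ν : ℕ} (u₀ : Eucl ν → Eucl ν) : Prop where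
  continuous : Continuous u₀
  curl_free : ∀ i j : Fin ν, ∀ η : Eucl ν → ℝ, ContDiff ℝ ∞ η → HasCompactSupport η →
    ∫ x, u₀ x i * fderiv ℝ η x (EuclideanSpace.single j 1) =
      ∫ x, u₀ x j * fderiv ℝ η x (EuclideanSpace.single i 1)
  bounded : ∃ C : ℝ, ∀ x, |linePotential u₀ x| ≤ C

/-- The Cole-Hopf transform `φ₀ = exp(-ψ₀)` of the initial datum. -/
def coleHopf {ν : ℕ} (u₀ : Eucl ν → Eucl ν) (x : Eucl ν) : ℝ :=
  Real.exp (-linePotential u₀ x)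

/-- The sup norm `‖∇g‖_∞ = sup_x |∇g(x)|` in `[0, ∞]`, for differentiable `g`. -/
def gradSupNorm {ν : ℕ} (g : Eucl ν → ℝ) : ℝ≥0∞ :=
  ⨆ x : Eucl ν, ‖fderiv ℝ g x‖ₑ

end

/-!
The gradient bound itself is soft. With `Q_t = (e^{-tH} φ₀) / Ω` one has `Q_t(x) = ∫ L_t(x, y)
Ω(y) φ₀(y) dy`, so writing `L_t(x + v, y) - L_t(x, y)` as an integral of `∂ₓ L_t` along the
segment and exchanging integrals gives `|Q_t(x + v) - Q_t(x)| ≤ b ‖φ₀‖_∞ |v| sup_z ∫ |∂ₓ L_t(z,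
y)| dy` (`enorm_fderiv_integral_le`). What needs work is the regularity behind this: `K_t` and `∫
K_t(x, y) f(y) dy`, for bounded `f`, must be differentiable in `x` and `K_t(x, ·)` must be
integrable.

All of it comes from Duhamel's formula, comparing `e^{-tH}` with the free semigroup `P_τ`, whose
kernel `p_τ(x - y)` is Gaussian. Since `Δ` is defined distributionally, the formula is derived by testing with
the Schwartz functions `p_τ(x - ·)`: differentiating `s ↦ e^{cs} ⟨p_{t-s+ε}(x - ·), e^{-sH} f⟩`
and integrating gives, for every real `c` (`duhamel_L2`), `e^{ct} P_ε e^{-tH} f = P_{t+ε} f + ∫₀ᵗ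
e^{cs} P_{t-s+ε} (c - V) e^{-sH} f ds`.

* For `c = M ≥ sup |V|` the factor `c - V` is nonnegative, and a Gronwall argument for the `L²`
  norm of the negative part shows that `e^{-tH}` preserves positivity (`semigroup_nonneg`).
* For `c = -M` the integral is then nonpositive, whence `0 ≤ K_t(x, y) ≤ e^{Mt} p_t(x - y)`
  (`kernel_nonneg`, `kernel_le`).
* For `c = 0` the Gaussian bound permits passing to bounded data and `ε → 0` (`duhamel_bounded`).
  The gradient of `P_τ g` is `O(τ^{-1/2}) ‖g‖_∞`, which is integrable near `τ = 0`, so the formula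
  can be differentiated under the integral (`differentiable_integral_kernel_mul`). As `K_t(·, y) =
  e^{-(t/2)H} K_{t/2}(·, y)` with `K_{t/2}(·, y)` bounded, the kernel is differentiable too.

That the semigroup and its continuous kernel exist is read off from `e^{-tH} Ω = Ω ≠ 0`, because
`expSemigroup` and `integralKernel` are `0` where no such object exists.
-/

/-! ### The Gaussian heat kernel -/

/-- The heat kernel `p_τ(z) = (2πτ)^{-ν/2} exp(-|z|²/(2τ))` of `½ Δ` on `ℝ^ν`. -/
noncomputable def gaussHeat {ν : ℕ} (τ : ℝ) (z : Eucl ν) : ℝ :=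
  (2 * Real.pi * τ) ^ (-(ν / 2 : ℝ)) * Real.exp (-(‖z‖ ^ 2 / (2 * τ)))

theorem gaussHeat_pos {ν : ℕ} {τ : ℝ} (hτ : 0 < τ) (z : Eucl ν) : 0 < gaussHeat τ z := by
  unfold gaussHeat; positivity

theorem gaussHeat_neg {ν : ℕ} (τ : ℝ) (z : Eucl ν) : gaussHeat τ (-z) = gaussHeat τ z := by
  simp [gaussHeat]

theorem gaussHeat_sub_comm {ν : ℕ} (τ : ℝ) (x y : Eucl ν) :
    gaussHeat τ (x - y) = gaussHeat τ (y - x) := by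
  rw [← gaussHeat_neg, neg_sub]

theorem integral_gaussHeat {ν : ℕ} {τ : ℝ} (hτ : 0 < τ) :
    ∫ z : Eucl ν, gaussHeat τ z = 1 := by
  have h := GaussianFourier.integral_rexp_neg_mul_sq_norm (V := Eucl ν)
    (b := (2 * τ)⁻¹) (by positivity)
  unfold gaussHeat
  rw [integral_const_mul]
  have e : ∀ z : Eucl ν, -(‖z‖ ^ 2 / (2 * τ)) = -(2 * τ)⁻¹ * ‖z‖ ^ 2 := fun z => by ring
  simp_rw [e]
  rw [h, finrank_euclideanSpace_fin]
  have : Real.pi / (2 * τ)⁻¹ = 2 * Real.pi * τ := by field_simp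
  rw [this, ← Real.rpow_add (by positivity)]
  simp

theorem integrable_gaussHeat {ν : ℕ} {τ : ℝ} (hτ : 0 < τ) :
    Integrable (fun z : Eucl ν => gaussHeat τ z) :=
  integrable_of_integral_eq_one (integral_gaussHeat hτ)

theorem integrable_gaussHeat_sub {ν : ℕ} {τ : ℝ} (hτ : 0 < τ) (x : Eucl ν) :
    Integrable (fun y : Eucl ν => gaussHeat τ (x - y)) :=
  (integrable_gaussHeat hτ).comp_sub_left x

theorem integral_gaussHeat_sub {ν : ℕ} {τ : ℝ} (hτ : 0 < τ) (x : Eucl ν) :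
    ∫ y : Eucl ν, gaussHeat τ (x - y) = 1 := by
  rw [integral_sub_left_eq_self (fun z => gaussHeat τ z), integral_gaussHeat hτ]

theorem continuousOn_gaussHeat {ν : ℕ} :
    ContinuousOn (fun p : ℝ × Eucl ν => gaussHeat p.1 p.2) {p | 0 < p.1} := by
  unfold gaussHeat
  apply ContinuousOn.mul
  · apply ContinuousOn.rpow_const (by fun_prop)
    intro p hp
    left
    have : 0 < p.1 := hp
    positivity
  · apply Continuous.comp_continuousOn Real.continuous_exp
    apply ContinuousOn.neg
    apply ContinuousOn.div (by fun_prop) (by fun_prop)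
    intro p hp
    have : 0 < p.1 := hp
    positivity

theorem continuous_gaussHeat {ν : ℕ} (τ : ℝ) : Continuous (fun z : Eucl ν => gaussHeat τ z) := by
  unfold gaussHeat; fun_prop

theorem gaussHeat_le {ν : ℕ} {τ : ℝ} (hτ : 0 < τ) (z : Eucl ν) :
    gaussHeat τ z ≤ (2 * Real.pi * τ) ^ (-(ν / 2 : ℝ)) := by
  unfold gaussHeat
  apply mul_le_of_le_one_right (by positivity)
  rw [Real.exp_le_one_iff]
  have : 0 ≤ ‖z‖ ^ 2 / (2 * τ) := by positivity
  linarith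

/-- Locally uniform domination of Gaussians by one Gaussian. -/
theorem exists_gaussHeat_sub_le (ν : ℕ) {α β : ℝ} (hα : 0 < α) (hαβ : α ≤ β) (r : ℝ) :
    ∃ C : ℝ, 0 < C ∧ ∀ τ, α ≤ τ → τ ≤ β → ∀ x₀ x y : Eucl ν, ‖x - x₀‖ ≤ r →
      gaussHeat τ (x - y) ≤ C * gaussHeat (2 * β) (x₀ - y) := by
  have hβ : 0 < β := hα.trans_le hαβ
  refine ⟨(2 * Real.pi * α) ^ (-(ν / 2 : ℝ)) * Real.exp (r ^ 2 / (2 * β)) /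
    (2 * Real.pi * (2 * β)) ^ (-(ν / 2 : ℝ)), by positivity, ?_⟩
  intro τ h1 h2 x₀ x y hx
  have hτ : 0 < τ := hα.trans_le h1
  unfold gaussHeat
  have hne : (2 * Real.pi * (2 * β)) ^ (-(ν / 2 : ℝ)) ≠ 0 := by positivity
  have e : (2 * Real.pi * α) ^ (-(ν / 2 : ℝ)) * Real.exp (r ^ 2 / (2 * β)) /
      (2 * Real.pi * (2 * β)) ^ (-(ν / 2 : ℝ)) * ((2 * Real.pi * (2 * β)) ^ (-(ν / 2 : ℝ)) *
        Real.exp (-(‖x₀ - y‖ ^ 2 / (2 * (2 * β))))) = (2 * Real.pi * α) ^ (-(ν / 2 : ℝ)) *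
        Real.exp (r ^ 2 / (2 * β) + (-(‖x₀ - y‖ ^ 2 / (2 * (2 * β))))) := by
    rw [Real.exp_add]; field_simp
  rw [e]
  apply mul_le_mul _ _ (by positivity) (by positivity)
  · apply Real.rpow_le_rpow_of_nonpos (by positivity) (by gcongr)
    have : (0 : ℝ) ≤ ν / 2 := by positivity
    linarith
  · rw [Real.exp_le_exp]
    have t : ‖x₀ - y‖ ≤ r + ‖x - y‖ := by
      calc ‖x₀ - y‖ = ‖(x₀ - x) + (x - y)‖ := by congr 1; abel
        _ ≤ ‖x₀ - x‖ + ‖x - y‖ := norm_add_le _ _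
        _ ≤ _ := by rw [norm_sub_rev]; gcongr
    have t2 : ‖x₀ - y‖ ^ 2 ≤ 2 * r ^ 2 + 2 * ‖x - y‖ ^ 2 := by
      calc ‖x₀ - y‖ ^ 2 ≤ (r + ‖x - y‖) ^ 2 := by gcongr
        _ ≤ _ := by nlinarith [sq_nonneg (r - ‖x - y‖)]
    have t3 : ‖x - y‖ ^ 2 / (2 * β) ≤ ‖x - y‖ ^ 2 / (2 * τ) := by gcongr
    have t4 : ‖x₀ - y‖ ^ 2 / (2 * (2 * β)) ≤ (2 * r ^ 2 + 2 * ‖x - y‖ ^ 2) / (2 * (2 * β)) := by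
      gcongr
    have t5 : (2 * r ^ 2 + 2 * ‖x - y‖ ^ 2) / (2 * (2 * β)) =
      r ^ 2 / (2 * β) + ‖x - y‖ ^ 2 / (2 * β) := by field_simp
    linarith

/-- Halving the exponent costs only a factor `2^{ν/2}`. -/
theorem gaussHeat_eq_two_mul {ν : ℕ} {τ : ℝ} (hτ : 0 < τ) (z : Eucl ν) :
    gaussHeat τ z = 2 ^ (ν / 2 : ℝ) * Real.exp (-(‖z‖ ^ 2 / (4 * τ))) * gaussHeat (2 * τ) z := by
  unfold gaussHeat
  have : (2 * Real.pi * (2 * τ)) ^ (-(ν / 2 : ℝ)) =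
      2 ^ (-(ν / 2 : ℝ)) * (2 * Real.pi * τ) ^ (-(ν / 2 : ℝ)) := by
    rw [← Real.mul_rpow (by positivity) (by positivity)]; ring_nf
  rw [this, Real.rpow_neg (by positivity : (0:ℝ) ≤ 2)]
  have e : Real.exp (-(‖z‖ ^ 2 / (2 * τ))) =
      Real.exp (-(‖z‖ ^ 2 / (4 * τ))) * Real.exp (-(‖z‖ ^ 2 / (2 * (2 * τ)))) := by
    rw [← Real.exp_add]; congr 1; field_simp; ring
  rw [e]
  field_simp

/-- The gradient bound `|∇p_τ| ≤ C τ^{-1/2} p_{2τ}`, where `|∇p_τ(z)| = |z| / τ * p_τ(z)`. -/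
theorem norm_div_mul_gaussHeat_le {ν : ℕ} {τ : ℝ} (hτ : 0 < τ) (z : Eucl ν) :
    ‖z‖ / τ * gaussHeat τ z ≤ 2 ^ (ν / 2 : ℝ) * (√τ)⁻¹ * gaussHeat (2 * τ) z := by
  rw [gaussHeat_eq_two_mul hτ]
  have h0 := gaussHeat_pos (ν := ν) (τ := 2 * τ) (by positivity) z
  have key : ‖z‖ / τ * Real.exp (-(‖z‖ ^ 2 / (4 * τ))) ≤ (√τ)⁻¹ := by
    have hs : 0 < √τ := Real.sqrt_pos.2 hτ
    have hsq : √τ ^ 2 = τ := Real.sq_sqrt hτ.le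
    have h1 : ‖z‖ / √τ ≤ Real.exp (‖z‖ ^ 2 / (4 * τ)) := by
      refine le_trans ?_ (Real.add_one_le_exp _)
      have : ‖z‖ ^ 2 / (4 * τ) = (‖z‖ / √τ / 2) ^ 2 := by
        rw [div_pow, div_pow, hsq]; field_simp; norm_num
      rw [this]
      nlinarith [sq_nonneg (‖z‖ / √τ / 2 - 1)]
    rw [Real.exp_neg, ← div_eq_mul_inv, div_le_iff₀ (Real.exp_pos _)]
    calc ‖z‖ / τ = (√τ)⁻¹ * (‖z‖ / √τ) := by
          field_simp; rw [hsq]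
      _ ≤ _ := by gcongr
  calc _ = 2 ^ (ν / 2 : ℝ) * (‖z‖ / τ * Real.exp (-(‖z‖ ^ 2 / (4 * τ)))) * gaussHeat (2 * τ) z := by
        ring
    _ ≤ _ := by gcongr

/-! ### Derivatives of the heat kernel -/

theorem hasDerivAt_gaussHeat_time {ν : ℕ} {τ : ℝ} (hτ : 0 < τ) (z : Eucl ν) :
    HasDerivAt (fun s => gaussHeat s z)
      ((‖z‖ ^ 2 / (2 * τ ^ 2) - ν / (2 * τ)) * gaussHeat τ z) τ := by
  unfold gaussHeat
  have h1 : HasDerivAt (fun s : ℝ => (2 * Real.pi * s) ^ (-(ν / 2 : ℝ)))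
      ((2 * Real.pi) * (-(ν / 2 : ℝ)) * (2 * Real.pi * τ) ^ (-(ν / 2 : ℝ) - 1)) τ := by
    have := ((hasDerivAt_id τ).const_mul (2 * Real.pi)).rpow_const (p := -(ν / 2 : ℝ))
      (Or.inl (by simp; positivity))
    simpa using this
  have h2 : HasDerivAt (fun s : ℝ => Real.exp (-(‖z‖ ^ 2 / (2 * s))))
      (Real.exp (-(‖z‖ ^ 2 / (2 * τ))) * (‖z‖ ^ 2 / (2 * τ ^ 2))) τ := by
    apply HasDerivAt.exp
    have h3 := ((hasDerivAt_inv hτ.ne').const_mul (-(‖z‖ ^ 2 / 2)))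
    convert! h3 using 1
    · ext s; rw [mul_comm 2 s, div_mul_eq_div_div, div_right_comm, div_eq_mul_inv _ s]; ring
    · field_simp
  convert! h1.mul h2 using 1
  rw [Real.rpow_sub_one (by positivity)]
  field_simp
  ring

theorem abs_deriv_gaussHeat_time_le {ν : ℕ} {τ : ℝ} (hτ : 0 < τ) (z : Eucl ν) :
    |(‖z‖ ^ 2 / (2 * τ ^ 2) - ν / (2 * τ)) * gaussHeat τ z| ≤
      2 ^ (ν / 2 : ℝ) * ((2 + ν) / τ) * gaussHeat (2 * τ) z := by
  have h0 := gaussHeat_pos (ν := ν) (τ := 2 * τ) (by positivity) z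
  rw [gaussHeat_eq_two_mul hτ]
  set E := Real.exp (-(‖z‖ ^ 2 / (4 * τ))) with hE
  have hE0 : 0 < E := Real.exp_pos _
  have hE1 : E ≤ 1 := by
    rw [hE, Real.exp_le_one_iff]
    have : 0 ≤ ‖z‖ ^ 2 / (4 * τ) := by positivity
    linarith
  have hE2 : ‖z‖ ^ 2 / (4 * τ) * E ≤ 1 := by
    rw [hE, Real.exp_neg, ← div_eq_mul_inv, div_le_one (Real.exp_pos _)]
    linarith [Real.add_one_le_exp (‖z‖ ^ 2 / (4 * τ))]
  have key : |(‖z‖ ^ 2 / (2 * τ ^ 2) - ν / (2 * τ)) * E| ≤ (2 + ν) / τ := by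
    have e1 : ‖z‖ ^ 2 / (2 * τ ^ 2) * E = 2 / τ * (‖z‖ ^ 2 / (4 * τ) * E) := by field_simp; norm_num
    have p1 : 0 ≤ ‖z‖ ^ 2 / (2 * τ ^ 2) * E := by positivity
    have p2 : 0 ≤ ν / (2 * τ) * E := by positivity
    have b1 : ‖z‖ ^ 2 / (2 * τ ^ 2) * E ≤ 2 / τ := by
      rw [e1]; exact mul_le_of_le_one_right (by positivity) hE2
    have b2 : ν / (2 * τ) * E ≤ ν / τ := by
      calc ν / (2 * τ) * E ≤ ν / (2 * τ) * 1 := by gcongr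
        _ ≤ ν / τ := by
          rw [mul_one]
          apply div_le_div_of_nonneg_left (by positivity) hτ (by linarith)
    rw [sub_mul, add_div, abs_le]
    constructor <;> nlinarith
  calc _ = 2 ^ (ν / 2 : ℝ) * |(‖z‖ ^ 2 / (2 * τ ^ 2) - ν / (2 * τ)) * E| * gaussHeat (2 * τ) z := by
        rw [show (‖z‖ ^ 2 / (2 * τ ^ 2) - ν / (2 * τ)) * (2 ^ (ν / 2 : ℝ) * E * gaussHeat (2 * τ) z)
          = 2 ^ (ν / 2 : ℝ) * ((‖z‖ ^ 2 / (2 * τ ^ 2) - ν / (2 * τ)) * E) * gaussHeat (2 * τ) z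
          by ring, abs_mul, abs_mul, abs_of_pos h0,
          abs_of_nonneg (by positivity : (0 : ℝ) ≤ 2 ^ (ν / 2 : ℝ))]
    _ ≤ _ := by gcongr

theorem hasFDerivAt_gaussHeat {ν : ℕ} (τ : ℝ) (z : Eucl ν) :
    HasFDerivAt (fun w : Eucl ν => gaussHeat τ w)
      ((-(gaussHeat τ z / τ)) • innerSL ℝ z) z := by
  unfold gaussHeat
  have h1 := (HasStrictFDerivAt.hasFDerivAt (hasStrictFDerivAt_norm_sq z))
  have h2 := ((h1.mul_const ((2 * τ)⁻¹)).neg.exp).const_mul ((2 * Real.pi * τ) ^ (-(ν / 2 : ℝ)))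
  convert! h2 using 1
  ext w
  simp
  rw [show ‖z‖ ^ 2 * (τ⁻¹ * 2⁻¹) = ‖z‖ ^ 2 / (2 * τ) by field_simp]
  ring

theorem norm_fderiv_gaussHeat_le {ν : ℕ} {τ : ℝ} (hτ : 0 < τ) (z : Eucl ν) :
    ‖(-(gaussHeat τ z / τ)) • innerSL ℝ z‖ ≤ 2 ^ (ν / 2 : ℝ) * (√τ)⁻¹ * gaussHeat (2 * τ) z := by
  have h := norm_div_mul_gaussHeat_le hτ z
  rw [norm_smul, innerSL_apply_norm, norm_neg, Real.norm_eq_abs,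
    abs_of_pos (div_pos (gaussHeat_pos hτ z) hτ)]
  calc _ = ‖z‖ / τ * gaussHeat τ z := by ring
    _ ≤ _ := h

/-! ### Gaussians as Schwartz functions -/

/-- A smooth function on the line which is `e^{-r}` for `r ≥ 0` and vanishes for `r ≤ -1`. -/
noncomputable def cutoffExp (r : ℝ) : ℝ := Real.smoothTransition (r + 1) * Real.exp (-r)

theorem cutoffExp_of_nonneg {r : ℝ} (hr : 0 ≤ r) : cutoffExp r = Real.exp (-r) := by
  rw [cutoffExp, Real.smoothTransition.one_of_one_le (by linarith), one_mul]

theorem contDiff_cutoffExp : ContDiff ℝ ∞ cutoffExp := by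
  unfold cutoffExp
  exact (Real.smoothTransition.contDiff.comp (by fun_prop)).mul (by fun_prop)

theorem abs_iteratedDeriv_cutoffExp_of_pos (n : ℕ) {r : ℝ} (hr : 0 < r) :
    |iteratedDeriv n cutoffExp r| = Real.exp (-r) := by
  have h : cutoffExp =ᶠ[𝓝 r] fun s => Real.exp ((-1) * s) := by
    filter_upwards [lt_mem_nhds hr] with s hs
    rw [cutoffExp_of_nonneg hs.le]; ring_nf
  rw [h.iteratedDeriv_eq, iteratedDeriv_exp_const_mul]
  simp [abs_mul]

theorem iteratedDeriv_cutoffExp_of_lt (n : ℕ) {r : ℝ} (hr : r < -1) :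
    iteratedDeriv n cutoffExp r = 0 := by
  have h : cutoffExp =ᶠ[𝓝 r] fun _ => 0 := by
    filter_upwards [gt_mem_nhds hr] with s hs
    rw [cutoffExp, Real.smoothTransition.zero_of_nonpos (by linarith), zero_mul]
  rw [h.iteratedDeriv_eq]
  simp

/-- `cutoffExp` as a Schwartz function. -/
noncomputable def cutoffExpSchwartz : 𝓢(ℝ, ℝ) where
  toFun := cutoffExp
  smooth' := contDiff_cutoffExp
  decay' := by
    intro k n
    have hc : Continuous fun r : ℝ => |r| ^ k * |iteratedDeriv n cutoffExp r| := by
      have := contDiff_cutoffExp.continuous_iteratedDeriv n (by exact_mod_cast le_top)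
      fun_prop
    obtain ⟨C, hC⟩ := (isCompact_Icc (a := (-1 : ℝ)) (b := 0)).bddAbove_image hc.continuousOn
    refine ⟨max C (k.factorial : ℝ), fun r => ?_⟩
    rw [norm_iteratedFDeriv_eq_norm_iteratedDeriv, Real.norm_eq_abs, Real.norm_eq_abs]
    rcases lt_or_ge 0 r with hr | hr
    · rw [abs_iteratedDeriv_cutoffExp_of_pos n hr, abs_of_pos hr]
      refine le_max_of_le_right ?_
      rw [Real.exp_neg, ← div_eq_mul_inv, div_le_iff₀ (Real.exp_pos _)]
      have := Real.pow_div_factorial_le_exp r hr.le k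
      rw [div_le_iff₀ (by positivity)] at this
      linarith
    · rcases lt_or_ge r (-1) with h1 | h1
      · rw [iteratedDeriv_cutoffExp_of_lt n h1]
        simp
      · exact le_max_of_le_left (hC ⟨r, ⟨h1, hr⟩, rfl⟩)

theorem exists_schwartz_gaussHeat {ν : ℕ} {τ : ℝ} (hτ : 0 < τ) (x : Eucl ν) :
    ∃ ψ : 𝓢(Eucl ν, ℝ), ∀ y, ψ y = gaussHeat τ (x - y) := by
  have hg : (fun y : Eucl ν => (2 * τ)⁻¹ * ‖y‖ ^ 2).HasTemperateGrowth := by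
    fun_prop
  have hup : ∃ (k : ℕ) (C : ℝ), ∀ y : Eucl ν, ‖y‖ ≤ C * (1 + ‖(2 * τ)⁻¹ * ‖y‖ ^ 2‖) ^ k := by
    refine ⟨1, 1 + 2 * τ, fun y => ?_⟩
    rw [pow_one, Real.norm_of_nonneg (by positivity)]
    have : (1 + 2 * τ) * (1 + (2 * τ)⁻¹ * ‖y‖ ^ 2) =
      1 + ‖y‖ ^ 2 + 2 * τ + (2 * τ)⁻¹ * ‖y‖ ^ 2 := by field_simp; ring
    rw [this]
    have p : 0 ≤ (2 * τ)⁻¹ * ‖y‖ ^ 2 := by positivity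
    nlinarith [sq_nonneg (‖y‖ - 1), norm_nonneg y]
  let ψ₀ : 𝓢(Eucl ν, ℝ) := SchwartzMap.compCLM ℝ hg hup cutoffExpSchwartz
  refine ⟨(2 * Real.pi * τ) ^ (-(ν / 2 : ℝ)) • SchwartzMap.compSubConstCLM ℝ x ψ₀, fun y => ?_⟩
  rw [gaussHeat_sub_comm]
  have : ψ₀ (y - x) = cutoffExp ((2 * τ)⁻¹ * ‖y - x‖ ^ 2) := rfl
  rw [smul_apply, SchwartzMap.compSubConstCLM_apply, this,
    cutoffExp_of_nonneg (by positivity), gaussHeat, smul_eq_mul]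
  congr 2
  field_simp

open LineDeriv in
/-- The Gaussian heat kernel solves the heat equation `∂_τ p = ½ Δ p`. -/
theorem laplacian_gaussHeat {ν : ℕ} {τ : ℝ} (hτ : 0 < τ) (x : Eucl ν) (ψ : 𝓢(Eucl ν, ℝ))
    (hψ : ∀ y, ψ y = gaussHeat τ (x - y)) (y : Eucl ν) :
    (Δ ψ) y = 2 * ((‖x - y‖ ^ 2 / (2 * τ ^ 2) - ν / (2 * τ)) * gaussHeat τ (x - y)) := by
  have hψ' : (ψ : Eucl ν → ℝ) = fun y => gaussHeat τ (x - y) := funext hψ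
  have hd : ∀ z : Eucl ν, HasFDerivAt (fun y => gaussHeat τ (x - y))
      ((gaussHeat τ (x - z) / τ) • innerSL ℝ (x - z)) z := by
    intro z
    have h := (hasFDerivAt_gaussHeat τ (x - z)).comp z ((hasFDerivAt_id z).const_sub x)
    refine HasFDerivAt.congr_fderiv h ?_
    ext w
    simp
  have h1 : ∀ (v z : Eucl ν),
      (∂_{v} ψ) z = gaussHeat τ (x - z) / τ * inner ℝ (x - z) v := by
    intro v z
    rw [SchwartzMap.lineDerivOp_apply_eq_fderiv, hψ', (hd z).fderiv]
    simp [inner_sub_left]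
  have h2 : ∀ (v : Eucl ν), ‖v‖ = 1 → (∂_{v} (∂_{v} ψ)) y =
      gaussHeat τ (x - y) / τ ^ 2 * (inner ℝ (x - y) v) ^ 2 - gaussHeat τ (x - y) / τ := by
    intro v hv
    rw [SchwartzMap.lineDerivOp_apply_eq_fderiv, show ((∂_{v} ψ : 𝓢(Eucl ν, ℝ)) : Eucl ν → ℝ) =
      fun z => gaussHeat τ (x - z) / τ * inner ℝ (x - z) v from funext (h1 v)]
    have hB : HasFDerivAt (fun z : Eucl ν => inner ℝ (x - z) v) (-(innerSL ℝ v)) y := by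
      have h := ((innerSL ℝ v).hasFDerivAt (x := x - y)).comp y ((hasFDerivAt_id y).const_sub x)
      refine HasFDerivAt.congr_fderiv (h.congr_of_eventuallyEq
        (Eventually.of_forall fun z => ?_)) ?_
      · simp [real_inner_comm]
      · ext w
        simp
    have hA : HasFDerivAt (fun z : Eucl ν => gaussHeat τ (x - z) / τ)
        (τ⁻¹ • (gaussHeat τ (x - y) / τ) • innerSL ℝ (x - y)) y := by
      simpa only [div_eq_mul_inv] using (hd y).mul_const τ⁻¹
    have h : HasFDerivAt (fun z => gaussHeat τ (x - z) / τ * inner ℝ (x - z) v) _ y := hA.mul hB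
    rw [h.fderiv]
    simp [hv, inner_sub_left]
    field_simp
    ring
  rw [SchwartzMap.laplacian_eq_sum (EuclideanSpace.basisFun (Fin ν) ℝ), sum_apply]
  rw [Finset.sum_congr rfl fun i _ => h2 _ (by simp)]
  rw [Finset.sum_sub_distrib, ← Finset.mul_sum]
  have := OrthonormalBasis.sum_sq_inner_right (EuclideanSpace.basisFun (Fin ν) ℝ) (x - y)
  have e2 : ∑ i, (inner ℝ (x - y) (EuclideanSpace.basisFun (Fin ν) ℝ i)) ^ 2 = ‖x - y‖ ^ 2 := by
    rw [← this]
    exact Finset.sum_congr rfl fun i _ => by rw [real_inner_comm]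
  rw [e2]
  simp
  field_simp

/-! ### Gaussians as vectors of `L²` -/

theorem memLp_gaussHeat_sub {ν : ℕ} {τ : ℝ} (hτ : 0 < τ) (x : Eucl ν) :
    MemLp (fun y => gaussHeat τ (x - y)) 2 (volume : Measure (Eucl ν)) := by
  obtain ⟨ψ, hψ⟩ := exists_schwartz_gaussHeat hτ x
  have h := ψ.memLp 2 (volume : Measure (Eucl ν))
  rwa [show (ψ : Eucl ν → ℝ) = fun y => gaussHeat τ (x - y) from funext hψ] at h

open scoped Classical in
/-- The translated heat kernel `p_τ(x - ·)` as a vector of `L²`, for `τ > 0` (and `0` otherwise). -/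
noncomputable def gaussL2 {ν : ℕ} (τ : ℝ) (x : Eucl ν) : L2 ν :=
  if h : 0 < τ then (memLp_gaussHeat_sub h x).toLp else 0

theorem coeFn_gaussL2 {ν : ℕ} {τ : ℝ} (hτ : 0 < τ) (x : Eucl ν) :
    gaussL2 τ x =ᵐ[volume] fun y => gaussHeat τ (x - y) := by
  rw [gaussL2, dif_pos hτ]
  exact MemLp.coeFn_toLp _

theorem inner_L2_eq_integral {ν : ℕ} (f g : L2 ν) : inner ℝ f g = ∫ y, f y * g y := by
  rw [L2.inner_def]
  congr 1
  ext y
  simp [mul_comm]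

theorem inner_gaussL2 {ν : ℕ} {τ : ℝ} (hτ : 0 < τ) (x : Eucl ν) (w : L2 ν) :
    inner ℝ (gaussL2 τ x) w = ∫ y, gaussHeat τ (x - y) * w y := by
  rw [inner_L2_eq_integral]
  apply integral_congr_ae
  filter_upwards [coeFn_gaussL2 hτ x] with y hy
  rw [hy]

theorem integrable_gaussHeat_mul_L2 {ν : ℕ} {τ : ℝ} (hτ : 0 < τ) (x : Eucl ν) (w : L2 ν) :
    Integrable (fun y => gaussHeat τ (x - y) * w y) :=
  (memLp_gaussHeat_sub hτ x).integrable_mul (Lp.memLp w)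

theorem norm_sq_L2 {ν : ℕ} (f : L2 ν) : ‖f‖ ^ 2 = ∫ y, f y ^ 2 := by
  rw [← real_inner_self_eq_norm_sq, inner_L2_eq_integral]
  simp_rw [sq]

/-- Near a given point `(τ₀, x₀)`, all `p_τ(x - ·)` are dominated by one Gaussian. -/
theorem exists_eventually_gaussHeat_le {ν : ℕ} {τ₀ : ℝ} (hτ₀ : 0 < τ₀) (x₀ : Eucl ν) :
    ∃ C : ℝ, 0 < C ∧ ∀ᶠ p : ℝ × Eucl ν in 𝓝 (τ₀, x₀), 0 < p.1 ∧
      ∀ y, gaussHeat p.1 (p.2 - y) ≤ C * gaussHeat (4 * τ₀) (x₀ - y) := by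
  obtain ⟨C, hC, h⟩ := exists_gaussHeat_sub_le ν (α := τ₀ / 2) (β := 2 * τ₀) (by positivity)
    (by linarith) 1
  refine ⟨C, hC, ?_⟩
  have h1 : ∀ᶠ p : ℝ × Eucl ν in 𝓝 (τ₀, x₀), τ₀ / 2 < p.1 :=
    continuous_fst.continuousAt.eventually_const_lt (by simp; linarith)
  have h2 : ∀ᶠ p : ℝ × Eucl ν in 𝓝 (τ₀, x₀), p.1 < 2 * τ₀ :=
    continuous_fst.continuousAt.eventually_lt_const (by simp; linarith)
  have h3 : ∀ᶠ p : ℝ × Eucl ν in 𝓝 (τ₀, x₀), ‖p.2 - x₀‖ < 1 := by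
    have : ContinuousAt (fun p : ℝ × Eucl ν => ‖p.2 - x₀‖) (τ₀, x₀) := by fun_prop
    exact this.eventually_lt_const (by simp)
  filter_upwards [h1, h2, h3] with p p1 p2 p3
  refine ⟨by linarith, fun y => ?_⟩
  have := h p.1 p1.le p2.le x₀ p.2 y p3.le
  rwa [show 2 * (2 * τ₀) = 4 * τ₀ by ring] at this

theorem tendsto_gaussHeat_sub {ν : ℕ} {τ₀ : ℝ} (hτ₀ : 0 < τ₀) (x₀ y : Eucl ν) :
    Tendsto (fun p : ℝ × Eucl ν => gaussHeat p.1 (p.2 - y)) (𝓝 (τ₀, x₀))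
      (𝓝 (gaussHeat τ₀ (x₀ - y))) := by
  have h1 : ContinuousAt (fun p : ℝ × Eucl ν => gaussHeat p.1 p.2) (τ₀, x₀ - y) :=
    continuousOn_gaussHeat.continuousAt ((isOpen_lt continuous_const continuous_fst).mem_nhds hτ₀)
  have h2 : ContinuousAt (fun p : ℝ × Eucl ν => (p.1, p.2 - y)) (τ₀, x₀) := by fun_prop
  exact ContinuousAt.comp (f := fun p : ℝ × Eucl ν => (p.1, p.2 - y)) h1 h2

theorem continuousOn_gaussL2 {ν : ℕ} :
    ContinuousOn (fun p : ℝ × Eucl ν => gaussL2 p.1 p.2) {p | 0 < p.1} := by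
  rintro ⟨τ₀, x₀⟩ (hτ₀ : 0 < τ₀)
  apply ContinuousAt.continuousWithinAt
  obtain ⟨C, hC, hev⟩ := exists_eventually_gaussHeat_le hτ₀ x₀
  rw [ContinuousAt, tendsto_iff_norm_sub_tendsto_zero]
  have key : Tendsto (fun p : ℝ × Eucl ν => ∫ y,
      (gaussHeat p.1 (p.2 - y) - gaussHeat τ₀ (x₀ - y)) ^ 2) (𝓝 (τ₀, x₀)) (𝓝 0) := by
    rw [show (0 : ℝ) = ∫ y : Eucl ν, (0 : ℝ) by simp]
    have hev0 := hev.self_of_nhds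
    apply tendsto_integral_filter_of_dominated_convergence
      (fun y => C ^ 2 * gaussHeat (4 * τ₀) (x₀ - y) ^ 2)
    · filter_upwards with p
      have := continuous_gaussHeat (ν := ν) p.1
      have := continuous_gaussHeat (ν := ν) τ₀
      exact Continuous.aestronglyMeasurable (by fun_prop)
    · filter_upwards [hev] with p hp
      filter_upwards with y
      have a1 := gaussHeat_pos hp.1 (p.2 - y)
      have a2 := gaussHeat_pos hτ₀ (x₀ - y)
      have a3 := hp.2 y
      have a4 := hev0.2 y
      simp only at a4
      rw [Real.norm_of_nonneg (sq_nonneg _), ← mul_pow]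
      apply sq_le_sq'
      · linarith
      · linarith
    · exact ((memLp_gaussHeat_sub (by positivity) x₀).integrable_sq).const_mul _
    · filter_upwards with y
      have := ((tendsto_gaussHeat_sub hτ₀ x₀ y).sub_const (gaussHeat τ₀ (x₀ - y))).pow 2
      simpa using this
  have e : ∀ᶠ p : ℝ × Eucl ν in 𝓝 (τ₀, x₀),
      ∫ y, (gaussHeat p.1 (p.2 - y) - gaussHeat τ₀ (x₀ - y)) ^ 2 =
        ‖gaussL2 p.1 p.2 - gaussL2 τ₀ x₀‖ ^ 2 := by
    filter_upwards [hev] with p hp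
    rw [norm_sq_L2]
    apply integral_congr_ae
    filter_upwards [Lp.coeFn_sub (gaussL2 p.1 p.2) (gaussL2 τ₀ x₀), coeFn_gaussL2 hp.1 p.2,
      coeFn_gaussL2 hτ₀ x₀] with y h1 h2 h3
    rw [h1, Pi.sub_apply, h2, h3]
  have h := (key.congr' e).sqrt
  simpa using h

/-- Pairing a fixed `w ∈ L²` with `p_τ(x - ·)`: the derivative in `τ`. -/
theorem hasDerivAt_integral_gaussHeat_mul {ν : ℕ} {τ : ℝ} (hτ : 0 < τ) (x : Eucl ν) (w : L2 ν) :
    HasDerivAt (fun s => ∫ y, gaussHeat s (x - y) * w y)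
      (∫ y, ((‖x - y‖ ^ 2 / (2 * τ ^ 2) - ν / (2 * τ)) * gaussHeat τ (x - y)) * w y) τ := by
  obtain ⟨C, hC, h⟩ := exists_gaussHeat_sub_le ν (α := τ) (β := 4 * τ) hτ
    (by linarith) 0
  have hnear : Ioo (τ / 2) (2 * τ) ∈ 𝓝 τ := Ioo_mem_nhds (by linarith) (by linarith)
  refine (hasDerivAt_integral_of_dominated_loc_of_deriv_le (s := Ioo (τ / 2) (2 * τ))
    (F := fun s y => gaussHeat s (x - y) * w y)
    (F' := fun s y => ((‖x - y‖ ^ 2 / (2 * s ^ 2) - ν / (2 * s)) * gaussHeat s (x - y)) * w y)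
    (bound := fun y => (2 ^ (ν / 2 : ℝ) * ((2 + ν) / (τ / 2)) * C) *
      (gaussHeat (8 * τ) (x - y) * ‖w y‖))
    hnear ?_ (integrable_gaussHeat_mul_L2 hτ x w) ?_ ?_ ?_ ?_).2
  · filter_upwards [hnear] with s hs
    exact (integrable_gaussHeat_mul_L2 (by linarith [hs.1]) x w).aestronglyMeasurable
  · have := continuous_gaussHeat (ν := ν) τ
    exact (Continuous.aestronglyMeasurable (by fun_prop)).mul (Lp.aestronglyMeasurable w)
  · filter_upwards with y s hs
    have hs0 : 0 < s := by linarith [hs.1]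
    have h8 := gaussHeat_pos (ν := ν) (τ := 8 * τ) (by positivity) (x - y)
    rw [norm_mul, Real.norm_eq_abs, ← mul_assoc]
    refine mul_le_mul_of_nonneg_right ?_ (norm_nonneg _)
    refine (abs_deriv_gaussHeat_time_le hs0 _).trans ?_
    have h2 := h (2 * s) (by linarith [hs.1]) (by linarith [hs.2]) x x y (by simp)
    rw [show 2 * (4 * τ) = 8 * τ by ring] at h2
    have h3 : (2 + (ν : ℝ)) / s ≤ (2 + ν) / (τ / 2) := by
      apply div_le_div_of_nonneg_left (by positivity) (by positivity) hs.1.le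
    calc _ ≤ 2 ^ (ν / 2 : ℝ) * ((2 + ν) / (τ / 2)) * (C * gaussHeat (8 * τ) (x - y)) := by
          gcongr
          exact (gaussHeat_pos (by linarith) _).le
      _ = _ := by ring
  · apply Integrable.const_mul
    have := (memLp_gaussHeat_sub (τ := 8 * τ) (by positivity) x).integrable_mul (Lp.memLp w).norm
    exact this
  · filter_upwards with y s hs
    exact (hasDerivAt_gaussHeat_time (by linarith [hs.1]) (x - y)).mul_const _

/-! ### Multiplication by a bounded function -/

theorem memLp_mul_L2 {ν : ℕ} {V : Eucl ν → ℝ} (hV : Continuous V) {M : ℝ} (hM : ∀ x, |V x| ≤ M)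
    (f : L2 ν) : MemLp (fun x => V x * f x) 2 volume := by
  refine MemLp.of_le_mul (c := M) (Lp.memLp f)
    (hV.aestronglyMeasurable.mul (Lp.aestronglyMeasurable f)) ?_
  filter_upwards with x
  rw [norm_mul]
  exact mul_le_mul_of_nonneg_right (hM x) (norm_nonneg _)

/-- Multiplication by a bounded continuous function, as a bounded operator on `L²`. -/
noncomputable def mulBounded {ν : ℕ} {V : Eucl ν → ℝ} (hV : Continuous V) {M : ℝ}
    (hM : ∀ x, |V x| ≤ M) : L2 ν →L[ℝ] L2 ν :=
  LinearMap.mkContinuous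
    { toFun := fun f => (memLp_mul_L2 hV hM f).toLp
      map_add' := fun f g =>
        (MemLp.toLp_congr _ ((memLp_mul_L2 hV hM f).add (memLp_mul_L2 hV hM g))
          (mul_add_ae V f g)).trans (MemLp.toLp_add _ _)
      map_smul' := fun c f =>
        (MemLp.toLp_congr _ ((memLp_mul_L2 hV hM f).const_smul c)
          (mul_smul_ae V c f)).trans (MemLp.toLp_const_smul c _) } M
    (by
      intro f
      refine Lp.norm_le_mul_norm_of_ae_le_mul ?_
      filter_upwards [(memLp_mul_L2 hV hM f).coeFn_toLp] with x hx
      rw [LinearMap.coe_mk, AddHom.coe_mk, hx, norm_mul]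
      exact mul_le_mul_of_nonneg_right (hM x) (norm_nonneg _))

theorem coeFn_mulBounded {ν : ℕ} {V : Eucl ν → ℝ} (hV : Continuous V) {M : ℝ}
    (hM : ∀ x, |V x| ≤ M) (f : L2 ν) :
    mulBounded hV hM f =ᵐ[volume] fun x => V x * f x :=
  (memLp_mul_L2 hV hM f).coeFn_toLp

theorem inner_gaussL2_mulBounded {ν : ℕ} {V : Eucl ν → ℝ} (hV : Continuous V) {M : ℝ}
    (hM : ∀ x, |V x| ≤ M) {τ : ℝ} (hτ : 0 < τ) (x : Eucl ν) (f : L2 ν) :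
    inner ℝ (gaussL2 τ x) (mulBounded hV hM f) = ∫ y, gaussHeat τ (x - y) * (V y * f y) := by
  rw [inner_gaussL2 hτ]
  apply integral_congr_ae
  filter_upwards [coeFn_mulBounded hV hM f] with y hy
  rw [hy]

theorem mem_graph_neg_schrodinger {ν : ℕ} {V : Eucl ν → ℝ} (hV : Continuous V) {M : ℝ}
    (hM : ∀ x, |V x| ≤ M) {f g : L2 ν} (h : (f, g) ∈ (-schrodinger V).graph)
    (ψ : 𝓢(Eucl ν, ℝ)) :
    ∫ x, g x * ψ x = (1 / 2) * (∫ x, f x * (Δ ψ) x) - ∫ x, ψ x * mulBounded hV hM f x := by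
  obtain ⟨y, hy1, hy2⟩ := LinearPMap.mem_graph_iff _ |>.1 h
  simp only at hy1 hy2
  have hyd : (y : L2 ν) ∈ (laplacianL2 ν).domain ⊓ (mulL2 V).domain := y.2
  let l : L2 ν := laplacianL2 ν ⟨y, hyd.1⟩
  have hl : ((y : L2 ν), l) ∈ laplacianGraph ν := by
    rw [← laplacianL2_graph]
    exact LinearPMap.mem_graph _ (⟨y, hyd.1⟩ : (laplacianL2 ν).domain)
  have e : g = (1 / 2 : ℝ) • l - mulBounded hV hM f := by
    rw [← hy2]
    have : (-schrodinger V) y = -((-(1 / 2) : ℝ) • l + mulL2 V ⟨y, hyd.2⟩) := rfl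
    rw [this]
    have e2 : mulL2 V ⟨y, hyd.2⟩ = mulBounded hV hM f := by
      subst hy1
      rfl
    rw [e2]
    module
  have h1 := hl ψ
  simp only at h1
  rw [hy1] at h1
  rw [← h1, e, ← integral_const_mul, ← integral_sub]
  · apply integral_congr_ae
    filter_upwards [Lp.coeFn_sub ((1 / 2 : ℝ) • l) (mulBounded hV hM f),
      Lp.coeFn_smul (1 / 2 : ℝ) l] with x hx1 hx2
    rw [hx1, Pi.sub_apply, hx2, Pi.smul_apply, smul_eq_mul]
    ring
  · exact (integrable_L2_mul_schwartz l ψ).const_mul _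
  · simpa only [mul_comm] using integrable_L2_mul_schwartz (mulBounded hV hM f) ψ

/-! ### Orbits of a strongly continuous semigroup -/

section Semigroup

variable {X : Type*} [NormedAddCommGroup X] [NormedSpace ℝ X] {A : X →ₗ.[ℝ] X} {T : ℝ → X →L[ℝ] X}

theorem IsSemigroupGeneratedBy.tendsto_apply (hT : IsSemigroupGeneratedBy A T) {f g : X}
    (h : (f, g) ∈ A.graph) {s : ℝ} (hs : 0 ≤ s) :
    Tendsto (fun t : ℝ => t⁻¹ • (T (s + t) f - T s f)) (𝓝[>] 0) (𝓝 (T s g)) := by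
  have h1 := ((T s).continuous.tendsto g).comp ((hT.generator f g).2 h)
  refine h1.congr' ?_
  filter_upwards [self_mem_nhdsWithin] with t (ht : 0 < t)
  simp [hT.add s t hs ht.le]

theorem IsSemigroupGeneratedBy.apply_mem_graph (hT : IsSemigroupGeneratedBy A T) {f g : X}
    (h : (f, g) ∈ A.graph) {s : ℝ} (hs : 0 ≤ s) : (T s f, T s g) ∈ A.graph := by
  rw [← hT.generator]
  refine (hT.tendsto_apply h hs).congr' ?_
  filter_upwards [self_mem_nhdsWithin] with t (ht : 0 < t)
  rw [add_comm, hT.add t s ht.le hs]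
  rfl

theorem IsSemigroupGeneratedBy.hasDerivWithinAt (hT : IsSemigroupGeneratedBy A T) {f g : X}
    (h : (f, g) ∈ A.graph) {s : ℝ} (hs : 0 ≤ s) :
    HasDerivWithinAt (fun r => T r f) (T s g) (Ioi s) s := by
  rw [hasDerivWithinAt_iff_tendsto_slope' (by simp)]
  have hm : Tendsto (fun r : ℝ => r - s) (𝓝[>] s) (𝓝[>] 0) := by
    apply tendsto_nhdsWithin_of_tendsto_nhds_of_eventually_within
    · have : ContinuousAt (fun r : ℝ => r - s) s := by fun_prop
      have h0 := this.tendsto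
      rw [sub_self] at h0
      exact h0.mono_left nhdsWithin_le_nhds
    · filter_upwards [self_mem_nhdsWithin] with r (hr : s < r)
      exact sub_pos.2 hr
  refine ((hT.tendsto_apply h hs).comp hm).congr fun r => ?_
  simp [slope]

variable [CompleteSpace X]

/-- The domain of the generator is dense: `f` is the limit of the means `n ∫₀^{1/n} T_r f dr`. -/
theorem IsSemigroupGeneratedBy.exists_seq_graph (hT : IsSemigroupGeneratedBy A T) (f : X) :
    ∃ u v : ℕ → X, (∀ n, (u n, v n) ∈ A.graph) ∧ Tendsto u atTop (𝓝 f) := by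
  set φ : ℝ → X := fun r => T (max r 0) f with hφ
  have hφc : Continuous φ :=
    (hT.continuousOn f).comp_continuous (by fun_prop) fun r => mem_Ici.2 (le_max_right _ _)
  set I : ℝ → X := fun u => ∫ r in (0 : ℝ)..u, φ r with hI
  have hI' : ∀ u, HasDerivAt I (φ u) u := fun u => hφc.integral_hasStrictDerivAt 0 u |>.hasDerivAt
  have hmem : ∀ δ : ℝ, 0 < δ → (I δ, T δ f - f) ∈ A.graph := by
    intro δ hδ
    rw [← hT.generator]
    have h1 : Tendsto (fun t : ℝ => t⁻¹ • (I (δ + t) - I δ)) (𝓝[>] 0) (𝓝 (φ δ)) :=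
      (hI' δ).tendsto_slope_zero_right
    have h2 : Tendsto (fun t : ℝ => t⁻¹ • (I (0 + t) - I 0)) (𝓝[>] 0) (𝓝 (φ 0)) :=
      (hI' 0).tendsto_slope_zero_right
    have e1 : φ δ = T δ f := by simp [hφ, max_eq_left hδ.le]
    have e2 : φ 0 = f := by simp [hφ, hT.zero]
    rw [e1] at h1
    rw [e2] at h2
    refine (h1.sub h2).congr' ?_
    filter_upwards [self_mem_nhdsWithin] with t (ht : 0 < t)
    have e3 : T t (I δ) = I (δ + t) - I t := by
      simp only [hI]
      rw [← ContinuousLinearMap.intervalIntegral_comp_comm _ (hφc.intervalIntegrable _ _),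
        intervalIntegral.integral_interval_sub_left (hφc.intervalIntegrable _ _)
          (hφc.intervalIntegrable _ _)]
      have : ∫ r in t..δ + t, φ r = ∫ r in (0 : ℝ)..δ, φ (r + t) := by
        rw [intervalIntegral.integral_comp_add_right, zero_add]
      rw [this]
      apply intervalIntegral.integral_congr
      intro r hr
      rw [uIcc_of_le hδ.le] at hr
      simp only [hφ]
      rw [max_eq_left hr.1, max_eq_left (by linarith [hr.1]), add_comm r t, hT.add t r ht.le hr.1]
      rfl
    rw [e3, ← smul_sub]
    congr 1
    simp only [zero_add, hI, intervalIntegral.integral_same, sub_zero]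
    abel
  refine ⟨fun n => ((n : ℝ) + 1) • I (1 / ((n : ℝ) + 1)),
    fun n => ((n : ℝ) + 1) • (T (1 / ((n : ℝ) + 1)) f - f), fun n => ?_, ?_⟩
  · exact A.graph.smul_mem ((n : ℝ) + 1) (hmem (1 / ((n : ℝ) + 1)) (by positivity))
  · have h2 : Tendsto (fun t : ℝ => t⁻¹ • (I (0 + t) - I 0)) (𝓝[>] 0) (𝓝 (φ 0)) :=
      (hI' 0).tendsto_slope_zero_right
    have e2 : φ 0 = f := by simp [hφ, hT.zero]
    rw [e2] at h2
    have h3 : Tendsto (fun n : ℕ => 1 / ((n : ℝ) + 1)) atTop (𝓝[>] 0) :=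
      tendsto_nhdsWithin_of_tendsto_nhds_of_eventually_within _
        tendsto_one_div_add_atTop_nhds_zero_nat
        (Eventually.of_forall fun n => by simp only [mem_Ioi]; positivity)
    refine (h2.comp h3).congr fun n => ?_
    simp [hI]

theorem IsSemigroupGeneratedBy.exists_norm_le (hT : IsSemigroupGeneratedBy A T) (t : ℝ) :
    ∃ C : ℝ, ∀ s ∈ Icc 0 t, ‖T s‖ ≤ C := by
  have hb : ∀ f, ∃ C, ∀ s : Icc 0 t, ‖T s f‖ ≤ C := by
    intro f
    have hc : ContinuousOn (fun s => ‖T s f‖) (Icc 0 t) :=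
      ((hT.continuousOn f).mono fun s hs => hs.1).norm
    obtain ⟨C, hC⟩ := isCompact_Icc.bddAbove_image hc
    exact ⟨C, fun s => hC ⟨s, s.2, rfl⟩⟩
  obtain ⟨C, hC⟩ := banach_steinhaus (g := fun s : Icc 0 t => T s) hb
  exact ⟨C, fun s hs => hC ⟨s, hs⟩⟩

end Semigroup

/-! ### Duhamel's formula -/

/-- Product rule for a pairing whose left factor is only weakly differentiable. -/
theorem hasDerivWithinAt_inner_of_weak {H : Type*} [NormedAddCommGroup H] [InnerProductSpace ℝ H]
    {Φ w : ℝ → H} {s d : ℝ} {w' : H} (hΦ : ContinuousWithinAt Φ (Ioi s) s)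
    (hw : HasDerivWithinAt w w' (Ioi s) s)
    (hd : HasDerivWithinAt (fun r => inner ℝ (Φ r) (w s)) d (Ioi s) s) :
    HasDerivWithinAt (fun r => inner ℝ (Φ r) (w r)) (d + inner ℝ (Φ s) w') (Ioi s) s := by
  rw [hasDerivWithinAt_iff_tendsto_slope' (by simp)] at *
  have h : Tendsto (fun r => slope (fun r => inner ℝ (Φ r) (w s)) s r +
    inner ℝ (Φ r) (slope w s r)) (𝓝[>] s) (𝓝 (d + inner ℝ (Φ s) w')) :=
    hd.add (hΦ.tendsto.inner hw)
  refine h.congr fun r => ?_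
  simp only [slope, vsub_eq_sub, inner_smul_right, inner_sub_right, smul_eq_mul]
  ring

section Duhamel

variable {ν : ℕ} {V : Eucl ν → ℝ} (hV : Continuous V) {M : ℝ} (hM : ∀ x, |V x| ≤ M)
  {T : ℝ → L2 ν →L[ℝ] L2 ν}

/-- The integrand of Duhamel's formula is jointly continuous. -/
theorem continuousOn_duhamel_integrand (hT : IsSemigroupGeneratedBy (-schrodinger V) T)
    (f : L2 ν) {B : L2 ν → L2 ν} (hB : Continuous B) (t : ℝ) {ε : ℝ} (hε : 0 < ε) :
    ContinuousOn (fun p : ℝ × Eucl ν => inner ℝ (gaussL2 (t - p.1 + ε) p.2) (B (T p.1 f)))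
      (Icc 0 t ×ˢ univ) := by
  apply ContinuousOn.inner
  · refine continuousOn_gaussL2.comp (f := fun p : ℝ × Eucl ν => (t - p.1 + ε, p.2))
      (by fun_prop) ?_
    rintro p ⟨hp, -⟩
    have := hp.2
    rw [mem_ofPred_eq]
    linarith
  · refine hB.comp_continuousOn ((hT.continuousOn f).comp (by fun_prop) ?_)
    rintro p ⟨hp, -⟩
    exact hp.1

theorem continuousOn_duhamel_integrand_time (hT : IsSemigroupGeneratedBy (-schrodinger V) T)
    (f : L2 ν) {B : L2 ν → L2 ν} (hB : Continuous B) (t : ℝ) {ε : ℝ} (hε : 0 < ε) (x : Eucl ν) :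
    ContinuousOn (fun s : ℝ => inner ℝ (gaussL2 (t - s + ε) x) (B (T s f))) (Icc 0 t) :=
  (continuousOn_duhamel_integrand hT f hB t hε).comp (f := fun s : ℝ => (s, x)) (by fun_prop)
    fun _ hs => ⟨hs, mem_univ _⟩

theorem duhamel_of_mem_graph (hT : IsSemigroupGeneratedBy (-schrodinger V) T) {f g : L2 ν}
    (hfg : (f, g) ∈ (-schrodinger V).graph) (c : ℝ) {t : ℝ} (ht : 0 ≤ t) {ε : ℝ} (hε : 0 < ε)
    (x : Eucl ν) :
    Real.exp (c * t) * inner ℝ (gaussL2 ε x) (T t f) = inner ℝ (gaussL2 (t + ε) x) f +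
      ∫ s in (0 : ℝ)..t, Real.exp (c * s) *
        inner ℝ (gaussL2 (t - s + ε) x) (c • T s f - mulBounded hV hM (T s f)) := by
  have hB : Continuous fun w : L2 ν => c • w - mulBounded hV hM w := by fun_prop
  have hF := intervalIntegral.integral_eq_sub_of_hasDeriv_right_of_le (a := 0) (b := t)
    (f := fun s => Real.exp (c * s) * inner ℝ (gaussL2 (t - s + ε) x) (T s f))
    (f' := fun s => Real.exp (c * s) *
        inner ℝ (gaussL2 (t - s + ε) x) (c • T s f - mulBounded hV hM (T s f))) ht ?_ ?_ ?_
  · rw [hF]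
    simp [hT.zero]
  · exact ContinuousOn.mul (by fun_prop)
      (continuousOn_duhamel_integrand_time hT f continuous_id t hε x)
  · intro s hs
    have hpos : 0 < t - s + ε := by linarith [hs.2]
    have hΦ : ContinuousWithinAt (fun r => gaussL2 (t - r + ε) x) (Ioi s) s := by
      apply ContinuousAt.continuousWithinAt
      have h1 : ContinuousAt (fun p : ℝ × Eucl ν => gaussL2 p.1 p.2) (t - s + ε, x) :=
        continuousOn_gaussL2.continuousAt
          ((isOpen_lt continuous_const continuous_fst).mem_nhds hpos)
      exact ContinuousAt.comp (f := fun r : ℝ => (t - r + ε, x)) h1 (by fun_prop)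
    obtain ⟨ψ, hψ⟩ := exists_schwartz_gaussHeat hpos x
    have hd : HasDerivWithinAt (fun r => inner ℝ (gaussL2 (t - r + ε) x) (T s f))
        (-((1 / 2) * ∫ y, T s f y * (Δ ψ) y)) (Ioi s) s := by
      apply HasDerivAt.hasDerivWithinAt
      have h1 := hasDerivAt_integral_gaussHeat_mul hpos x (T s f)
      have h2 : HasDerivAt (fun r : ℝ => t - r + ε) (-1) s :=
        ((hasDerivAt_id s).const_sub t).add_const ε
      have h3 := h1.comp s h2
      have h4 : ∫ y, ((‖x - y‖ ^ 2 / (2 * (t - s + ε) ^ 2) - ν / (2 * (t - s + ε))) *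
          gaussHeat (t - s + ε) (x - y)) * T s f y = (1 / 2) * ∫ y, T s f y * (Δ ψ) y := by
        rw [← integral_const_mul]
        congr 1
        ext y
        rw [laplacian_gaussHeat hpos x ψ hψ y]
        ring
      rw [h4, mul_neg_one] at h3
      refine h3.congr_of_eventuallyEq ?_
      have hev : ∀ᶠ r in 𝓝 s, r < t := gt_mem_nhds hs.2
      filter_upwards [hev] with r hr
      rw [inner_gaussL2 (by linarith)]
      rfl
    have h1 := hasDerivWithinAt_inner_of_weak hΦ (hT.hasDerivWithinAt hfg hs.1.le) hd
    have h2 : HasDerivWithinAt (fun r : ℝ => Real.exp (c * r)) (Real.exp (c * s) * c)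
        (Ioi s) s := by
      have := ((hasDerivAt_id s).const_mul c).exp
      simpa using this.hasDerivWithinAt
    refine (h2.mul h1).congr_deriv ?_
    have h3 : inner ℝ (gaussL2 (t - s + ε) x) (T s g) =
        (1 / 2) * (∫ y, T s f y * (Δ ψ) y) -
          inner ℝ (gaussL2 (t - s + ε) x) (mulBounded hV hM (T s f)) := by
      have h4 := mem_graph_neg_schrodinger hV hM (hT.apply_mem_graph hfg hs.1.le) ψ
      rw [inner_gaussL2 hpos, inner_gaussL2 hpos]
      simp_rw [← hψ]
      rw [← h4]
      simp_rw [mul_comm]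
    rw [h3, inner_sub_right, inner_smul_right]
    ring
  · apply ContinuousOn.intervalIntegrable
    rw [uIcc_of_le ht]
    exact ContinuousOn.mul (by fun_prop)
      (continuousOn_duhamel_integrand_time hT f hB t hε x)

/-- Duhamel's formula for `e^{ct} e^{-tH} f`, tested on Gaussians: the perturbation of the free
semigroup is multiplication by `c - V`. -/
theorem duhamel_L2 (hT : IsSemigroupGeneratedBy (-schrodinger V) T) (f : L2 ν)
    (c : ℝ) {t : ℝ} (ht : 0 ≤ t) {ε : ℝ} (hε : 0 < ε) (x : Eucl ν) :
    Real.exp (c * t) * inner ℝ (gaussL2 ε x) (T t f) = inner ℝ (gaussL2 (t + ε) x) f +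
      ∫ s in (0 : ℝ)..t, Real.exp (c * s) *
        inner ℝ (gaussL2 (t - s + ε) x) (c • T s f - mulBounded hV hM (T s f)) := by
  obtain ⟨u, v, huv, hu⟩ := hT.exists_seq_graph f
  have hB : Continuous fun w : L2 ν => c • w - mulBounded hV hM w := by fun_prop
  obtain ⟨C, hC⟩ := hT.exists_norm_le t
  have hgc : ContinuousOn (fun s : ℝ => gaussL2 (t - s + ε) x) (Icc 0 t) := by
    refine continuousOn_gaussL2.comp (f := fun s : ℝ => (t - s + ε, x)) (by fun_prop) ?_
    intro s hs
    have := hs.2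
    rw [mem_ofPred_eq]
    linarith
  obtain ⟨D, hD⟩ := isCompact_Icc.bddAbove_image hgc.norm
  obtain ⟨R, hR⟩ := (Metric.isBounded_range_of_tendsto u hu).exists_norm_le
  have hlim1 : Tendsto (fun n => Real.exp (c * t) * inner ℝ (gaussL2 ε x) (T t (u n))) atTop
      (𝓝 (Real.exp (c * t) * inner ℝ (gaussL2 ε x) (T t f))) := by
    have : Continuous fun w => Real.exp (c * t) * inner ℝ (gaussL2 ε x) (T t w) := by fun_prop
    exact (this.tendsto f).comp hu
  have hlim2 : Tendsto (fun n => inner ℝ (gaussL2 (t + ε) x) (u n)) atTop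
      (𝓝 (inner ℝ (gaussL2 (t + ε) x) f)) := tendsto_const_nhds.inner hu
  have hlim3 : Tendsto (fun n => ∫ s in (0 : ℝ)..t, Real.exp (c * s) *
        inner ℝ (gaussL2 (t - s + ε) x) (c • T s (u n) - mulBounded hV hM (T s (u n)))) atTop
      (𝓝 (∫ s in (0 : ℝ)..t, Real.exp (c * s) *
        inner ℝ (gaussL2 (t - s + ε) x) (c • T s f - mulBounded hV hM (T s f)))) := by
    apply intervalIntegral.tendsto_integral_filter_of_dominated_convergence
      (fun s => Real.exp (c * s) * (D * ((|c| + ‖mulBounded hV hM‖) * (C * R))))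
    · filter_upwards with n
      rw [uIoc_of_le ht]
      refine ContinuousOn.aestronglyMeasurable (ContinuousOn.mul (by fun_prop)
        ((continuousOn_duhamel_integrand_time hT (u n) hB t hε x).mono Ioc_subset_Icc_self))
        measurableSet_Ioc
    · filter_upwards with n
      filter_upwards with s hs
      rw [uIoc_of_le ht] at hs
      have hs' : s ∈ Icc 0 t := Ioc_subset_Icc_self hs
      have b1 : ‖gaussL2 (t - s + ε) x‖ ≤ D := hD ⟨s, hs', rfl⟩
      have b2 : ‖T s (u n)‖ ≤ C * R := by
        refine (T s).le_of_opNorm_le_of_le (hC s hs') (hR _ ⟨n, rfl⟩)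
      rw [norm_mul, Real.norm_of_nonneg (Real.exp_pos _).le]
      refine mul_le_mul_of_nonneg_left ?_ (Real.exp_pos _).le
      refine (norm_inner_le_norm _ _).trans ?_
      refine mul_le_mul b1 ?_ (norm_nonneg _) ((norm_nonneg _).trans b1)
      calc _ ≤ ‖c • T s (u n)‖ + ‖mulBounded hV hM (T s (u n))‖ := norm_sub_le _ _
        _ ≤ |c| * ‖T s (u n)‖ + ‖mulBounded hV hM‖ * ‖T s (u n)‖ := by
          gcongr
          · rw [norm_smul, Real.norm_eq_abs]
          · exact (mulBounded hV hM).le_opNorm _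
        _ = (|c| + ‖mulBounded hV hM‖) * ‖T s (u n)‖ := by ring
        _ ≤ _ := by gcongr
    · exact (Continuous.intervalIntegrable (by fun_prop) _ _)
    · filter_upwards with s hs
      have : Continuous fun w => Real.exp (c * s) *
        inner ℝ (gaussL2 (t - s + ε) x) (c • T s w - mulBounded hV hM (T s w)) := by fun_prop
      exact (this.tendsto f).comp hu
  refine tendsto_nhds_unique hlim1 ?_
  refine (hlim2.add hlim3).congr fun n => ?_
  rw [← duhamel_of_mem_graph hV hM hT (huv n) c ht hε x]

end Duhamel

/-! ### Mollification, averages and continuous kernels -/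

theorem tendsto_pow_mul_gaussHeat_cobounded (ν : ℕ) :
    Tendsto (fun z : Eucl ν => ‖z‖ ^ ν * gaussHeat 1 z) (Bornology.cobounded _) (𝓝 0) := by
  have h1 : Tendsto (fun t : ℝ => t ^ ν * Real.exp (-t)) atTop (𝓝 0) :=
    Real.tendsto_pow_mul_exp_neg_atTop_nhds_zero ν
  have h2 := ((h1.comp (tendsto_norm_cobounded_atTop (E := Eucl ν))).const_mul
    ((2 * Real.pi * 1) ^ (-(ν / 2 : ℝ)) * Real.exp (1 / 2)))
  rw [mul_zero] at h2
  refine squeeze_zero (fun z => ?_) (fun z => ?_) h2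
  · have := gaussHeat_pos (ν := ν) one_pos z
    positivity
  · have : Real.exp (-(‖z‖ ^ 2 / (2 * 1))) ≤ Real.exp (1 / 2) * Real.exp (-‖z‖) := by
      rw [← Real.exp_add, Real.exp_le_exp]
      nlinarith [sq_nonneg (‖z‖ - 1)]
    simp only [Function.comp_apply, gaussHeat]
    calc ‖z‖ ^ ν * ((2 * Real.pi * 1) ^ (-(ν / 2 : ℝ)) * Real.exp (-(‖z‖ ^ 2 / (2 * 1))))
        ≤ ‖z‖ ^ ν * ((2 * Real.pi * 1) ^ (-(ν / 2 : ℝ)) *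
            (Real.exp (1 / 2) * Real.exp (-‖z‖))) := by
          gcongr
      _ = _ := by ring

/-- The Gaussians `p_ε` are an approximate identity, also for functions `g` which are merely
integrable against a Gaussian. -/
theorem tendsto_integral_gaussHeat_mul {ν : ℕ} {g : Eucl ν → ℝ} {x : Eucl ν}
    (hg : Integrable fun y => gaussHeat 1 (x - y) * g y) (hx : ContinuousAt g x) :
    Tendsto (fun ε : ℝ => ∫ y, gaussHeat ε (x - y) * g y) (𝓝[>] 0) (𝓝 (g x)) := by
  -- With `c² = 1/ε - 1`, `p_ε` is `p_1` rescaled by `c`, times the weight `exp(-|x - y|²/2)`.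
  set G : Eucl ν → ℝ := fun y => (2 * Real.pi * 1) ^ ((ν / 2 : ℝ)) * (gaussHeat 1 (x - y) * g y)
    with hG
  have hGx : G x = g x := by
    simp only [hG, sub_self, gaussHeat]
    rw [Real.rpow_neg (by positivity)]
    field_simp
    simp
  have hGc : ContinuousAt G x := by
    have := continuous_gaussHeat (ν := ν) 1
    have h2 : ContinuousAt (fun y => gaussHeat 1 (x - y)) x := by fun_prop
    exact continuousAt_const.mul (h2.mul hx)
  have h1 := tendsto_integral_comp_smul_smul_of_integrable' (μ := (volume : Measure (Eucl ν)))
    (φ := gaussHeat 1) (fun z => (gaussHeat_pos one_pos z).le) (integral_gaussHeat one_pos)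
    (by simpa using tendsto_pow_mul_gaussHeat_cobounded ν) (hg.const_mul _) hGc
  have hc : Tendsto (fun ε : ℝ => √(ε⁻¹ - 1)) (𝓝[>] 0) atTop :=
    Real.tendsto_sqrt_atTop.comp (tendsto_atTop_add_const_right _ (-1) tendsto_inv_nhdsGT_zero)
  have h2 : Tendsto (fun ε : ℝ => (1 - ε) ^ (-(ν / 2 : ℝ))) (𝓝[>] 0) (𝓝 1) := by
    have : ContinuousAt (fun ε : ℝ => (1 - ε) ^ (-(ν / 2 : ℝ))) 0 := by
      apply ContinuousAt.rpow_const (by fun_prop)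
      left; norm_num
    have h := this.tendsto
    simp only [sub_zero, Real.one_rpow] at h
    exact h.mono_left nhdsWithin_le_nhds
  have h3 := h2.mul (h1.comp hc)
  rw [one_mul] at h3
  change Tendsto _ _ (𝓝 (G x)) at h3
  rw [hGx] at h3
  refine h3.congr' ?_
  have hlt : ∀ᶠ ε : ℝ in 𝓝[>] 0, ε < 1 :=
    (gt_mem_nhds one_pos).filter_mono nhdsWithin_le_nhds
  filter_upwards [self_mem_nhdsWithin, hlt] with ε (h0 : 0 < ε) h1
  simp only [Function.comp_apply]
  rw [← integral_const_mul]
  congr 1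
  ext y
  have hpos : 0 < ε⁻¹ - 1 := by
    rw [sub_pos]; exact (one_lt_inv₀ h0).2 h1
  have hcsq : √(ε⁻¹ - 1) ^ 2 = ε⁻¹ - 1 := Real.sq_sqrt hpos.le
  have hcpow : √(ε⁻¹ - 1) ^ ν = (ε⁻¹ - 1) ^ (ν / 2 : ℝ) := by
    rw [Real.sqrt_eq_rpow, ← Real.rpow_natCast, ← Real.rpow_mul hpos.le]
    congr 1; ring
  rw [finrank_euclideanSpace_fin, hcpow, smul_eq_mul]
  simp only [gaussHeat, norm_smul, mul_pow, Real.norm_eq_abs, sq_abs, hcsq]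
  have e1 : Real.exp (-(‖x - y‖ ^ 2 / (2 * ε))) =
      Real.exp (-((ε⁻¹ - 1) * ‖x - y‖ ^ 2 / (2 * 1))) * Real.exp (-(‖x - y‖ ^ 2 / (2 * 1))) := by
    rw [← Real.exp_add]
    congr 1
    field_simp
    ring
  have e2 : (2 * Real.pi * ε) ^ (-(ν / 2 : ℝ)) =
      (1 - ε) ^ (-(ν / 2 : ℝ)) * (ε⁻¹ - 1) ^ (ν / 2 : ℝ) * (2 * Real.pi * 1) ^ (-(ν / 2 : ℝ)) := by
    have e3 : ε⁻¹ - 1 = (1 - ε) / ε := by field_simp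
    have : 0 < 1 - ε := by linarith
    rw [e3, Real.div_rpow this.le h0.le, mul_one, Real.mul_rpow (by positivity) h0.le,
      Real.rpow_neg this.le, Real.rpow_neg h0.le, Real.rpow_neg (by positivity)]
    field_simp
  have e4 : (2 * Real.pi * 1) ^ (-(ν / 2 : ℝ)) * (2 * Real.pi * 1) ^ (ν / 2 : ℝ) = 1 := by
    rw [← Real.rpow_add (by positivity)]; simp
  rw [e1, e2]
  linear_combination ((1 - ε) ^ (-(ν / 2 : ℝ)) * (ε⁻¹ - 1) ^ (ν / 2 : ℝ) *
    (2 * Real.pi * 1) ^ (-(ν / 2 : ℝ)) * Real.exp (-((ε⁻¹ - 1) * ‖x - y‖ ^ 2 / (2 * 1))) *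
    Real.exp (-(‖x - y‖ ^ 2 / (2 * 1))) * g y) * e4

/-- The Cauchy-Schwarz inequality for a weighted integral. -/
theorem sq_integral_mul_le {α : Type*} [MeasurableSpace α] {μ : Measure α} {p g : α → ℝ}
    (hp0 : ∀ a, 0 ≤ p a) (hp : Integrable p μ) (hpg : Integrable (fun a => p a * g a) μ)
    (hpg2 : Integrable (fun a => p a * g a ^ 2) μ) :
    (∫ a, p a * g a ∂μ) ^ 2 ≤ (∫ a, p a ∂μ) * ∫ a, p a * g a ^ 2 ∂μ := by
  have h : ∀ c : ℝ, 0 ≤ (∫ a, p a ∂μ) * (c * c) + (-2 * ∫ a, p a * g a ∂μ) * c +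
      ∫ a, p a * g a ^ 2 ∂μ := by
    intro c
    have h1 : 0 ≤ ∫ a, p a * (g a - c) ^ 2 ∂μ :=
      integral_nonneg fun a => mul_nonneg (hp0 a) (sq_nonneg _)
    have h2 : ∫ a, p a * (g a - c) ^ 2 ∂μ = ∫ a, (c * c) * p a + (-2 * c) * (p a * g a) +
        p a * g a ^ 2 ∂μ := by
      congr 1; ext a; ring
    have h3 : Integrable (fun a => (c * c) * p a + (-2 * c) * (p a * g a)) μ :=
      (hp.const_mul _).add (hpg.const_mul _)
    rw [h2, integral_add h3 hpg2,
      integral_add (hp.const_mul _) (hpg.const_mul _), integral_const_mul, integral_const_mul] at h1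
    linarith
  have := discrim_le_zero h
  rw [discrim] at this
  nlinarith

/-- Averaging with `p_τ` is a contraction in `L²`. -/
theorem lintegral_sq_inner_gaussL2_le {ν : ℕ} {τ : ℝ} (hτ : 0 < τ) (w : L2 ν) :
    ∫⁻ x, ENNReal.ofReal (inner ℝ (gaussL2 τ x) w ^ 2) ≤ ENNReal.ofReal (‖w‖ ^ 2) := by
  have hw2 : Integrable fun y => w y ^ 2 := (Lp.memLp w).integrable_sq
  have hp := continuous_gaussHeat (ν := ν) τ
  have hb : ∀ x y : Eucl ν, ‖gaussHeat τ (x - y)‖ ≤ (2 * Real.pi * τ) ^ (-(ν / 2 : ℝ)) := by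
    intro x y
    rw [Real.norm_of_nonneg (gaussHeat_pos hτ _).le]
    exact gaussHeat_le hτ _
  have hpw2 : ∀ x : Eucl ν, Integrable fun y => gaussHeat τ (x - y) * w y ^ 2 := by
    intro x
    exact hw2.bdd_mul (Continuous.aestronglyMeasurable (by fun_prop)) (Eventually.of_forall (hb x))
  have hm : Measurable w := (Lp.stronglyMeasurable w).measurable
  calc ∫⁻ x, ENNReal.ofReal (inner ℝ (gaussL2 τ x) w ^ 2)
      ≤ ∫⁻ x, ∫⁻ y, ENNReal.ofReal (gaussHeat τ (x - y) * w y ^ 2) := by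
        apply lintegral_mono
        intro x
        simp only
        rw [← ofReal_integral_eq_lintegral_ofReal (hpw2 x) (Eventually.of_forall fun y =>
          mul_nonneg (gaussHeat_pos hτ _).le (sq_nonneg _))]
        apply ENNReal.ofReal_le_ofReal
        have := sq_integral_mul_le (fun y => (gaussHeat_pos hτ (x - y)).le)
          (integrable_gaussHeat_sub hτ x) (integrable_gaussHeat_mul_L2 hτ x w) (hpw2 x)
        rwa [integral_gaussHeat_sub hτ, one_mul, ← inner_gaussL2 hτ] at this
    _ = ∫⁻ y, ∫⁻ x, ENNReal.ofReal (gaussHeat τ (x - y) * w y ^ 2) := by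
        apply lintegral_lintegral_swap
        apply Measurable.aemeasurable
        apply Measurable.ennreal_ofReal
        apply Measurable.mul
        · exact (hp.comp (continuous_fst.sub continuous_snd)).measurable
        · exact (hm.comp measurable_snd).pow_const 2
    _ = ∫⁻ y, ENNReal.ofReal (w y ^ 2) := by
        congr 1
        ext y
        simp_rw [mul_comm (gaussHeat τ _) _, ENNReal.ofReal_mul (sq_nonneg (w y))]
        rw [lintegral_const_mul' _ _ ENNReal.ofReal_ne_top, ← ofReal_integral_eq_lintegral_ofReal]
        · rw [integral_sub_right_eq_self (fun z => gaussHeat τ z), integral_gaussHeat hτ]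
          simp
        · exact (integrable_gaussHeat hτ).comp_sub_right y
        · exact Eventually.of_forall fun x => (gaussHeat_pos hτ _).le
    _ = ENNReal.ofReal (‖w‖ ^ 2) := by
        rw [norm_sq_L2, ofReal_integral_eq_lintegral_ofReal hw2
          (Eventually.of_forall fun y => sq_nonneg _)]
    _ ≤ _ := le_rfl

theorem continuous_setIntegral_closedBall {ν : ℕ} {k : Eucl ν → Eucl ν → ℝ}
    (hk : Continuous fun p : Eucl ν × Eucl ν => k p.1 p.2) (y₀ : Eucl ν) (r : ℝ) :
    Continuous fun x => ∫ y in Metric.closedBall y₀ r, k x y :=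
  continuous_parametric_integral_of_continuous hk (isCompact_closedBall y₀ r)

/-- A continuous kernel is nonnegative if its integrals over balls are. -/
theorem kernel_nonneg_of_setIntegral {ν : ℕ} {k : Eucl ν → Eucl ν → ℝ}
    (hk : Continuous fun p : Eucl ν × Eucl ν => k p.1 p.2)
    (h : ∀ (y₀ : Eucl ν) (r : ℝ), 0 < r →
      ∀ᵐ x, 0 ≤ ∫ y in Metric.closedBall y₀ r, k x y) (x y : Eucl ν) : 0 ≤ k x y := by
  by_contra hneg
  push Not at hneg
  have hopen : IsOpen {p : Eucl ν × Eucl ν | k p.1 p.2 < k x y / 2} :=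
    isOpen_lt hk continuous_const
  obtain ⟨r, hr, hball⟩ := Metric.isOpen_iff.1 hopen (x, y)
    (show k x y < k x y / 2 by linarith)
  obtain ⟨z, hz, hzr⟩ := (Measure.dense_of_ae (h y (r / 2) (by positivity))).exists_mem_open
    Metric.isOpen_ball (Metric.nonempty_ball.2 hr : (Metric.ball x r).Nonempty)
  have hle : ∀ w ∈ Metric.closedBall y (r / 2), k z w ≤ k x y / 2 := by
    intro w hw
    have : (z, w) ∈ Metric.ball (x, y) r := by
      rw [← ball_prod_same]
      exact ⟨hzr, Metric.closedBall_subset_ball (by linarith) hw⟩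
    exact (hball this).le
  have hcz : Continuous fun w => k z w := hk.comp (Continuous.prodMk_right z)
  have h1 : ∫ w in Metric.closedBall y (r / 2), k z w ≤
      ∫ _ in Metric.closedBall y (r / 2), k x y / 2 :=
    setIntegral_mono_on (hcz.continuousOn.integrableOn_compact (isCompact_closedBall _ _))
      (continuous_const.continuousOn.integrableOn_compact (isCompact_closedBall _ _))
      Metric.isClosed_closedBall.measurableSet hle
  rw [setIntegral_const, smul_eq_mul] at h1
  have hv : 0 < (volume : Measure (Eucl ν)).real (Metric.closedBall y (r / 2)) :=
    ENNReal.toReal_pos (Metric.measure_closedBall_pos _ _ (by positivity)).ne'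
      measure_closedBall_lt_top.ne
  have hz' : 0 ≤ ∫ w in Metric.closedBall y (r / 2), k z w := hz
  nlinarith

/-- Continuous kernels with the same integrals over balls agree. -/
theorem kernel_eq_of_setIntegral {ν : ℕ} {k l : Eucl ν → Eucl ν → ℝ}
    (hk : Continuous fun p : Eucl ν × Eucl ν => k p.1 p.2)
    (hl : Continuous fun p : Eucl ν × Eucl ν => l p.1 p.2)
    (h : ∀ (y₀ : Eucl ν) (r : ℝ), 0 < r →
      ∀ᵐ x, ∫ y in Metric.closedBall y₀ r, k x y = ∫ y in Metric.closedBall y₀ r, l x y)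
    (x y : Eucl ν) : k x y = l x y := by
  have hint : ∀ {m : Eucl ν → Eucl ν → ℝ}, (Continuous fun p : Eucl ν × Eucl ν => m p.1 p.2) →
      ∀ y₀ r z, IntegrableOn (m z) (Metric.closedBall y₀ r) := fun hm y₀ r z =>
    (hm.comp (Continuous.prodMk_right z)).continuousOn.integrableOn_compact
      (isCompact_closedBall _ _)
  apply le_antisymm
  · have := kernel_nonneg_of_setIntegral (k := fun x y => l x y - k x y) (hl.sub hk)
      (fun y₀ r hr => by
        filter_upwards [h y₀ r hr] with z hz
        rw [integral_sub (hint hl y₀ r z) (hint hk y₀ r z), hz, sub_self]) x y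
    linarith
  · have := kernel_nonneg_of_setIntegral (k := fun x y => k x y - l x y) (hk.sub hl)
      (fun y₀ r hr => by
        filter_upwards [h y₀ r hr] with z hz
        rw [integral_sub (hint hk y₀ r z) (hint hl y₀ r z), hz, sub_self]) x y
    linarith

/-! ### Positivity and the Gaussian upper bound -/

theorem inner_gaussL2_mono {ν : ℕ} {τ : ℝ} (hτ : 0 < τ) (x : Eucl ν) {f g : L2 ν}
    (h : f ≤ᵐ[volume] g) : inner ℝ (gaussL2 τ x) f ≤ inner ℝ (gaussL2 τ x) g := by
  rw [inner_gaussL2 hτ, inner_gaussL2 hτ]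
  refine integral_mono_ae (integrable_gaussHeat_mul_L2 hτ x f)
    (integrable_gaussHeat_mul_L2 hτ x g) ?_
  filter_upwards [h] with y hy
  exact mul_le_mul_of_nonneg_left hy (gaussHeat_pos hτ _).le

theorem inner_gaussL2_nonneg {ν : ℕ} {τ : ℝ} (hτ : 0 < τ) (x : Eucl ν) {f : L2 ν}
    (h : ∀ᵐ y, 0 ≤ f y) : 0 ≤ inner ℝ (gaussL2 τ x) f := by
  rw [inner_gaussL2 hτ]
  apply integral_nonneg_of_ae
  filter_upwards [h] with y hy
  exact mul_nonneg (gaussHeat_pos hτ _).le hy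

theorem tendsto_inner_gaussL2 {ν : ℕ} {w : L2 ν} {g : Eucl ν → ℝ} (hw : w =ᵐ[volume] g)
    (hg : Continuous g) (x : Eucl ν) :
    Tendsto (fun ε : ℝ => inner ℝ (gaussL2 ε x) w) (𝓝[>] 0) (𝓝 (g x)) := by
  have e : ∀ ε : ℝ, ∫ y, gaussHeat ε (x - y) * w y = ∫ y, gaussHeat ε (x - y) * g y := by
    intro ε
    apply integral_congr_ae
    filter_upwards [hw] with y hy
    rw [hy]
  have hint : Integrable fun y => gaussHeat 1 (x - y) * g y := by
    refine (integrable_gaussHeat_mul_L2 one_pos x w).congr ?_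
    filter_upwards [hw] with y hy
    rw [hy]
  refine (tendsto_integral_gaussHeat_mul hint hg.continuousAt).congr' ?_
  filter_upwards [self_mem_nhdsWithin] with ε hε
  rw [inner_gaussL2 hε, e]

/-- An integral form of Gronwall's inequality with zero initial value. -/
theorem eq_zero_of_le_integral {m : ℝ → ℝ} (hm : ContinuousOn m (Ici 0)) (hm0 : ∀ t, 0 ≤ m t)
    {C : ℝ} (hC : 0 ≤ C) (h : ∀ t, 0 < t → m t ≤ C * t * ∫ s in (0 : ℝ)..t, m s) {t : ℝ}
    (ht : 0 < t) : m t = 0 := by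
  set φ : ℝ → ℝ := fun s => m (max s 0) with hφ
  have hφc : Continuous φ := hm.comp_continuous (by fun_prop) fun r => mem_Ici.2 (le_max_right _ _)
  have hφm : ∀ u, 0 ≤ u → ∫ s in (0 : ℝ)..u, φ s = ∫ s in (0 : ℝ)..u, m s := by
    intro u hu
    apply intervalIntegral.integral_congr
    intro s hs
    rw [uIcc_of_le hu] at hs
    simp [hφ, max_eq_left hs.1]
  set N : ℝ → ℝ := fun u => ∫ s in (0 : ℝ)..u, φ s with hN
  have hN' : ∀ u, HasDerivAt N (φ u) u := fun u => (hφc.integral_hasStrictDerivAt 0 u).hasDerivAt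
  have hN0 : ∀ u, 0 ≤ u → 0 ≤ N u := fun u hu =>
    intervalIntegral.integral_nonneg hu fun s _ => hm0 _
  have hN1 : N 0 = 0 := by simp [hN]
  have hφ0 : φ 0 ≤ 0 := by
    -- the hypothesis only concerns `t > 0`, so `m 0 = 0` needs continuity at `0`
    have l1 : Tendsto φ (𝓝[>] 0) (𝓝 (φ 0)) := (hφc.tendsto 0).mono_left nhdsWithin_le_nhds
    have l2 : Tendsto (fun u => C * u * N u) (𝓝[>] 0) (𝓝 0) := by
      have hNc : Continuous N := continuous_iff_continuousAt.2 fun u => (hN' u).continuousAt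
      have : Continuous fun u => C * u * N u := by fun_prop
      have h0 := this.tendsto 0
      simp only [mul_zero, zero_mul] at h0
      exact h0.mono_left nhdsWithin_le_nhds
    refine le_of_tendsto_of_tendsto l1 l2 ?_
    filter_upwards [self_mem_nhdsWithin] with u (hu : 0 < u)
    have := h u hu
    rw [← hφm u hu.le] at this
    simpa [hφ, max_eq_left hu.le] using this
  have hgr := norm_le_gronwallBound_of_norm_deriv_right_le (f := N) (f' := φ) (δ := 0)
    (K := C * t) (ε := 0) (a := 0) (b := t)
    (continuous_iff_continuousAt.2 fun u => (hN' u).continuousAt).continuousOn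
    (fun u _ => (hN' u).hasDerivWithinAt) (by simp [hN1]) (fun u hu => by
      rw [Real.norm_of_nonneg (hm0 _), Real.norm_of_nonneg (hN0 u hu.1), add_zero]
      rcases hu.1.eq_or_lt with h0 | h0
      · rw [← h0, hN1, mul_zero]
        exact hφ0
      · have := h u h0
        rw [← hφm u h0.le] at this
        have e : φ u = m u := by simp [hφ, max_eq_left h0.le]
        refine e.le.trans (this.trans ?_)
        exact mul_le_mul_of_nonneg_right (mul_le_mul_of_nonneg_left hu.2.le hC) (hN0 u hu.1))
    t ⟨ht.le, le_rfl⟩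
  rw [gronwallBound_ε0_δ0] at hgr
  have hNt : N t = 0 := by simpa using hgr
  have := h t ht
  rw [← hφm t ht.le] at this
  change m t ≤ C * t * N t at this
  rw [hNt, mul_zero] at this
  exact le_antisymm this (hm0 t)

section Positivity

variable {ν : ℕ} {V : Eucl ν → ℝ} {T : ℝ → L2 ν →L[ℝ] L2 ν}

/-- The negative part of the mollified solution is controlled by the negative part at earlier
times. -/
theorem neg_inner_gaussL2_le (hV : Continuous V) {M : ℝ}
    (hM : ∀ x, |V x| ≤ M) (hT : IsSemigroupGeneratedBy (-schrodinger V) T) {f : L2 ν}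
    (hf : ∀ᵐ y, 0 ≤ f y) {t : ℝ} (ht : 0 ≤ t) {ε : ℝ} (hε : 0 < ε) (x : Eucl ν) :
    -inner ℝ (gaussL2 ε x) (T t f) ≤
      2 * M * ∫ s in (0 : ℝ)..t, inner ℝ (gaussL2 (t - s + ε) x) (Lp.negPart (T s f)) := by
  have hM0 : 0 ≤ M := (abs_nonneg _).trans (hM 0)
  have hB : Continuous fun w : L2 ν => M • w - mulBounded hV hM w := by fun_prop
  have hD := duhamel_L2 hV hM hT f M ht hε x
  have hfpos := inner_gaussL2_nonneg (τ := t + ε) (by linarith) x hf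
  have hcn := continuousOn_duhamel_integrand_time hT f (Lp.continuous_negPart (p := 2)
    (μ := (volume : Measure (Eucl ν)))) t hε x
  have hpt : ∀ s ∈ Icc 0 t,
      -(Real.exp (M * t) * (2 * M) * inner ℝ (gaussL2 (t - s + ε) x) (Lp.negPart (T s f))) ≤
      Real.exp (M * s) *
        inner ℝ (gaussL2 (t - s + ε) x) (M • T s f - mulBounded hV hM (T s f)) := by
    intro s hs
    have hpos : 0 < t - s + ε := by linarith [hs.2]
    have h1 : inner ℝ (gaussL2 (t - s + ε) x) ((-(2 * M)) • Lp.negPart (T s f)) ≤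
        inner ℝ (gaussL2 (t - s + ε) x) (M • T s f - mulBounded hV hM (T s f)) := by
      apply inner_gaussL2_mono hpos
      filter_upwards [Lp.coeFn_smul (-(2 * M)) (Lp.negPart (T s f)),
        Lp.coeFn_negPart_eq_max (T s f), Lp.coeFn_sub (M • T s f) (mulBounded hV hM (T s f)),
        Lp.coeFn_smul M (T s f), coeFn_mulBounded hV hM (T s f)] with y h1 h2 h3 h4 h5
      rw [h1, h3, Pi.smul_apply, h2, Pi.sub_apply, h4, h5, Pi.smul_apply, smul_eq_mul, smul_eq_mul]
      have hVy := abs_le.1 (hM y)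
      rcases le_total 0 (T s f y) with h0 | h0
      · rw [max_eq_right (by linarith)]
        nlinarith
      · rw [max_eq_left (by linarith)]
        nlinarith
    rw [inner_smul_right] at h1
    have h2 : 0 ≤ inner ℝ (gaussL2 (t - s + ε) x) (Lp.negPart (T s f)) := by
      apply inner_gaussL2_nonneg hpos
      filter_upwards [Lp.coeFn_negPart_eq_max (T s f)] with y hy
      rw [hy]
      exact le_max_right _ _
    have h3 : Real.exp (M * s) ≤ Real.exp (M * t) := by
      rw [Real.exp_le_exp]
      exact mul_le_mul_of_nonneg_left hs.2 hM0
    calc _ ≤ -(Real.exp (M * s) * (2 * M) *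
          inner ℝ (gaussL2 (t - s + ε) x) (Lp.negPart (T s f))) := by
          gcongr
      _ = Real.exp (M * s) * (-(2 * M) *
          inner ℝ (gaussL2 (t - s + ε) x) (Lp.negPart (T s f))) := by ring
      _ ≤ _ := by gcongr
  have hint := intervalIntegral.integral_mono_on (μ := volume) ht
    (ContinuousOn.intervalIntegrable (by
      rw [uIcc_of_le ht]
      exact (continuousOn_const.mul hcn).neg))
    (ContinuousOn.intervalIntegrable (by
      rw [uIcc_of_le ht]
      exact ContinuousOn.mul (by fun_prop)
        (continuousOn_duhamel_integrand_time hT f hB t hε x))) hpt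
  rw [intervalIntegral.integral_neg, intervalIntegral.integral_const_mul] at hint
  have he := Real.exp_pos (M * t)
  have hfin : Real.exp (M * t) * -(inner ℝ (gaussL2 ε x) (T t f)) ≤ Real.exp (M * t) *
      (2 * M * ∫ s in (0 : ℝ)..t, inner ℝ (gaussL2 (t - s + ε) x) (Lp.negPart (T s f))) := by
    linarith
  exact le_of_mul_le_mul_left hfin he

/-- The squared `L²` norm of the negative part of the mollified solution, uniformly in `ε`. -/
theorem lintegral_sq_negPart_mollified_le (hV : Continuous V) {M : ℝ}
    (hM : ∀ x, |V x| ≤ M) (hT : IsSemigroupGeneratedBy (-schrodinger V) T)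
    {f : L2 ν} (hf : ∀ᵐ y, 0 ≤ f y) {t : ℝ} (ht : 0 ≤ t) {ε : ℝ} (hε : 0 < ε) :
    ∫⁻ x, ENNReal.ofReal (max (-inner ℝ (gaussL2 ε x) (T t f)) 0 ^ 2) ≤
      ENNReal.ofReal ((2 * M) ^ 2 * t * ∫ s in (0 : ℝ)..t, ‖Lp.negPart (T s f)‖ ^ 2) := by
  have hM0 : 0 ≤ M := (abs_nonneg _).trans (hM 0)
  have hnc := Lp.continuous_negPart (p := 2) (μ := (volume : Measure (Eucl ν)))
  set b : ℝ → Eucl ν → ℝ := fun s x => inner ℝ (gaussL2 (t - s + ε) x) (Lp.negPart (T s f)) with hb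
  have hbc : ContinuousOn (fun p : ℝ × Eucl ν => b p.1 p.2) (Icc 0 t ×ˢ univ) :=
    continuousOn_duhamel_integrand hT f hnc t hε
  have hbx : ∀ x, ContinuousOn (fun s => b s x) (Icc 0 t) := fun x =>
    continuousOn_duhamel_integrand_time hT f hnc t hε x
  have hb0 : ∀ x, ∀ s ∈ Icc 0 t, 0 ≤ b s x := by
    intro x s hs
    apply inner_gaussL2_nonneg (by linarith [hs.2])
    filter_upwards [Lp.coeFn_negPart_eq_max (T s f)] with y hy
    rw [hy]
    exact le_max_right _ _
  have hmc : ContinuousOn (fun s => ‖Lp.negPart (T s f)‖ ^ 2) (Icc 0 t) :=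
    ((hnc.comp_continuousOn ((hT.continuousOn f).mono fun s hs => hs.1)).norm.pow 2)
  have hint : ∀ {φ : ℝ → ℝ}, ContinuousOn φ (Icc 0 t) → Integrable φ (volume.restrict (Ioc 0 t)) :=
    fun hφ => (hφ.integrableOn_compact isCompact_Icc).mono_set Ioc_subset_Icc_self
  have hbx2 : ∀ x, ContinuousOn (fun s => b s x ^ 2) (Icc 0 t) := fun x => (hbx x).pow 2
  have hstep : ∀ x, ENNReal.ofReal (max (-inner ℝ (gaussL2 ε x) (T t f)) 0 ^ 2) ≤
      ENNReal.ofReal ((2 * M) ^ 2 * t) * ∫⁻ s in Ioc 0 t, ENNReal.ofReal (b s x ^ 2) := by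
    intro x
    have h1 := neg_inner_gaussL2_le hV hM hT hf ht hε x
    have hI0 : 0 ≤ ∫ s in (0 : ℝ)..t, b s x := intervalIntegral.integral_nonneg ht (hb0 x)
    have h2 : max (-inner ℝ (gaussL2 ε x) (T t f)) 0 ≤ 2 * M * ∫ s in (0 : ℝ)..t, b s x :=
      max_le h1 (by positivity)
    have h3 := sq_integral_mul_le (μ := volume.restrict (Ioc 0 t)) (p := fun _ => (1 : ℝ))
      (g := fun s => b s x) (fun _ => zero_le_one) (hint continuousOn_const)
      (by simpa using hint (hbx x)) (by simpa using hint (hbx2 x))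
    simp only [one_mul, integral_const, smul_eq_mul, mul_one] at h3
    rw [intervalIntegral.integral_of_le ht] at h2 hI0
    have h4 : max (-inner ℝ (gaussL2 ε x) (T t f)) 0 ^ 2 ≤
        (2 * M) ^ 2 * t * ∫ s in Ioc 0 t, b s x ^ 2 := by
      calc _ ≤ (2 * M * ∫ s in Ioc 0 t, b s x) ^ 2 := by
            gcongr
        _ = (2 * M) ^ 2 * (∫ s in Ioc 0 t, b s x) ^ 2 := by ring
        _ ≤ (2 * M) ^ 2 * (t * ∫ s in Ioc 0 t, b s x ^ 2) := by
            gcongr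
            simpa [ht] using h3
        _ = _ := by ring
    rw [← ofReal_integral_eq_lintegral_ofReal (hint (hbx2 x))
      (Eventually.of_forall fun s => sq_nonneg _), ← ENNReal.ofReal_mul (by positivity)]
    exact ENNReal.ofReal_le_ofReal h4
  calc _ ≤ ∫⁻ x, ENNReal.ofReal ((2 * M) ^ 2 * t) *
        ∫⁻ s in Ioc 0 t, ENNReal.ofReal (b s x ^ 2) := lintegral_mono hstep
    _ = ENNReal.ofReal ((2 * M) ^ 2 * t) *
        ∫⁻ x, ∫⁻ s in Ioc 0 t, ENNReal.ofReal (b s x ^ 2) :=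
        lintegral_const_mul' _ _ ENNReal.ofReal_ne_top
    _ = ENNReal.ofReal ((2 * M) ^ 2 * t) *
        ∫⁻ s in Ioc 0 t, ∫⁻ x, ENNReal.ofReal (b s x ^ 2) := by
        congr 1
        symm
        apply lintegral_lintegral_swap
        have hms : MeasurableSet (Ioc 0 t ×ˢ (univ : Set (Eucl ν))) :=
          measurableSet_Ioc.prod MeasurableSet.univ
        have h1 : ContinuousOn (fun p : ℝ × Eucl ν => b p.1 p.2 ^ 2) (Ioc 0 t ×ˢ univ) :=
          (hbc.pow 2).mono (prod_mono Ioc_subset_Icc_self le_rfl)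
        have h2 := (h1.aemeasurable (μ := (volume : Measure ℝ).prod volume) hms).ennreal_ofReal
        rwa [← Measure.prod_restrict, Measure.restrict_univ] at h2
    _ ≤ ENNReal.ofReal ((2 * M) ^ 2 * t) *
        ∫⁻ s in Ioc 0 t, ENNReal.ofReal (‖Lp.negPart (T s f)‖ ^ 2) := by
        gcongr 1
        apply setLIntegral_mono_ae' measurableSet_Ioc
        filter_upwards with s hs
        exact lintegral_sq_inner_gaussL2_le (by linarith [hs.2]) _
    _ = _ := by
        rw [← ofReal_integral_eq_lintegral_ofReal (hint hmc)
          (Eventually.of_forall fun s => sq_nonneg _), ← ENNReal.ofReal_mul (by positivity),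
          intervalIntegral.integral_of_le ht]

/-- Positivity preservation: `f ≥ 0` implies `e^{-tH} f ≥ 0`, provided that the `e^{-tH} f`
have continuous representatives. Mollifying with `p_ε` and letting `ε → 0`, the squared `L²` norm of
the negative part satisfies a Gronwall inequality. -/
theorem semigroup_nonneg (hV : Continuous V) {M : ℝ}
    (hM : ∀ x, |V x| ≤ M) (hT : IsSemigroupGeneratedBy (-schrodinger V) T)
    {f : L2 ν} (hf : ∀ᵐ y, 0 ≤ f y)
    (hrep : ∀ t, 0 < t → ∃ g : Eucl ν → ℝ, Continuous g ∧ T t f =ᵐ[volume] g) {t : ℝ}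
    (ht : 0 < t) : ∀ᵐ y, 0 ≤ T t f y := by
  have hM0 : 0 ≤ M := (abs_nonneg _).trans (hM 0)
  have hnc := Lp.continuous_negPart (p := 2) (μ := (volume : Measure (Eucl ν)))
  have hmc : ContinuousOn (fun s => ‖Lp.negPart (T s f)‖ ^ 2) (Ici 0) :=
    (hnc.comp_continuousOn (hT.continuousOn f)).norm.pow 2
  have hgr : ∀ t, 0 < t → ‖Lp.negPart (T t f)‖ ^ 2 ≤
      (2 * M) ^ 2 * t * ∫ s in (0 : ℝ)..t, ‖Lp.negPart (T s f)‖ ^ 2 := by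
    intro t ht
    obtain ⟨g, hg, hTg⟩ := hrep t ht
    have hR0 : 0 ≤ (2 * M) ^ 2 * t * ∫ s in (0 : ℝ)..t, ‖Lp.negPart (T s f)‖ ^ 2 := by
      have : 0 ≤ ∫ s in (0 : ℝ)..t, ‖Lp.negPart (T s f)‖ ^ 2 :=
        intervalIntegral.integral_nonneg ht.le fun s _ => sq_nonneg _
      positivity
    rw [← ENNReal.ofReal_le_ofReal_iff hR0]
    set ε : ℕ → ℝ := fun n => 1 / ((n : ℝ) + 1) with hε
    have hε0 : ∀ n, 0 < ε n := fun n => by simp only [hε]; positivity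
    have hεt : Tendsto ε atTop (𝓝[>] 0) :=
      tendsto_nhdsWithin_of_tendsto_nhds_of_eventually_within _
        tendsto_one_div_add_atTop_nhds_zero_nat
        (Eventually.of_forall hε0)
    have hlim : ∀ x, Tendsto
        (fun n => ENNReal.ofReal (max (-inner ℝ (gaussL2 (ε n) x) (T t f)) 0 ^ 2)) atTop
        (𝓝 (ENNReal.ofReal (max (-g x) 0 ^ 2))) := by
      intro x
      have h := (tendsto_inner_gaussL2 hTg hg x).comp hεt
      exact ENNReal.tendsto_ofReal (((h.neg).max tendsto_const_nhds).pow 2)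
    have hmeas : ∀ n, Measurable
        fun x => ENNReal.ofReal (max (-inner ℝ (gaussL2 (ε n) x) (T t f)) 0 ^ 2) := by
      intro n
      have hc : Continuous fun x => inner ℝ (gaussL2 (ε n) x) (T t f) := by
        refine Continuous.inner ?_ continuous_const
        exact continuousOn_gaussL2.comp_continuous (f := fun x : Eucl ν => (ε n, x)) (by fun_prop)
          fun x => hε0 n
      exact ((hc.neg.max continuous_const).pow 2).measurable.ennreal_ofReal
    calc ENNReal.ofReal (‖Lp.negPart (T t f)‖ ^ 2)
        = ∫⁻ x, ENNReal.ofReal (max (-g x) 0 ^ 2) := by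
          rw [norm_sq_L2, ofReal_integral_eq_lintegral_ofReal (Lp.memLp _).integrable_sq
            (Eventually.of_forall fun s => sq_nonneg _)]
          apply lintegral_congr_ae
          filter_upwards [Lp.coeFn_negPart_eq_max (T t f), hTg] with x h1 h2
          rw [h1, h2]
      _ = ∫⁻ x, liminf
          (fun n => ENNReal.ofReal (max (-inner ℝ (gaussL2 (ε n) x) (T t f)) 0 ^ 2)) atTop := by
          congr 1
          ext x
          exact (hlim x).liminf_eq.symm
      _ ≤ liminf (fun n => ∫⁻ x,
          ENNReal.ofReal (max (-inner ℝ (gaussL2 (ε n) x) (T t f)) 0 ^ 2)) atTop :=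
          lintegral_liminf_le hmeas
      _ ≤ liminf (fun _ : ℕ => ENNReal.ofReal
          ((2 * M) ^ 2 * t * ∫ s in (0 : ℝ)..t, ‖Lp.negPart (T s f)‖ ^ 2)) atTop :=
          liminf_le_liminf (Eventually.of_forall fun n =>
            lintegral_sq_negPart_mollified_le hV hM hT hf ht.le (hε0 n))
      _ = _ := liminf_const _
  have h0 := eq_zero_of_le_integral hmc (fun s => sq_nonneg _) (sq_nonneg (2 * M)) hgr ht
  have h1 : Lp.negPart (T t f) = 0 := by simpa using h0
  filter_upwards [Lp.coeFn_negPart_eq_max (T t f),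
    Lp.coeFn_zero ℝ 2 (volume : Measure (Eucl ν))] with y h2 h3
  rw [h1, h3, Pi.zero_apply] at h2
  have := le_max_left (-T t f y) 0
  linarith

end Positivity

section KernelBounds

variable {ν : ℕ} {V : Eucl ν → ℝ} {T : ℝ → L2 ν →L[ℝ] L2 ν} {K : ℝ → Eucl ν → Eucl ν → ℝ}

/-- The indicator function of a closed ball in `L²`. -/
noncomputable def ballL2 {ν : ℕ} (y₀ : Eucl ν) (r : ℝ) : L2 ν :=
  indicatorConstLp 2 (Metric.isClosed_closedBall (x := y₀) (ε := r)).measurableSet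
    measure_closedBall_lt_top.ne 1

theorem integral_mul_ballL2 {ν : ℕ} (k : Eucl ν → ℝ) (y₀ : Eucl ν) (r : ℝ) :
    ∫ y, k y * ballL2 y₀ r y = ∫ y in Metric.closedBall y₀ r, k y := by
  rw [← integral_indicator Metric.isClosed_closedBall.measurableSet]
  apply integral_congr_ae
  filter_upwards [indicatorConstLp_coeFn (p := 2) (c := (1 : ℝ))
    (hs := (Metric.isClosed_closedBall (x := y₀) (ε := r)).measurableSet)
    (hμs := (measure_closedBall_lt_top (μ := (volume : Measure (Eucl ν)))).ne)] with y hy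
  rw [ballL2, hy]
  by_cases h : y ∈ Metric.closedBall y₀ r <;> simp [h]

theorem ballL2_nonneg {ν : ℕ} (y₀ : Eucl ν) (r : ℝ) : ∀ᵐ y, 0 ≤ ballL2 y₀ r y := by
  filter_upwards [indicatorConstLp_coeFn (p := 2) (c := (1 : ℝ))
    (hs := (Metric.isClosed_closedBall (x := y₀) (ε := r)).measurableSet)
    (hμs := (measure_closedBall_lt_top (μ := (volume : Measure (Eucl ν)))).ne)] with y hy
  rw [ballL2, hy]
  exact indicator_nonneg (fun _ _ => zero_le_one) _

theorem apply_ballL2_ae_eq {S : L2 ν →L[ℝ] L2 ν} {k : Eucl ν → Eucl ν → ℝ}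
    (hk : IsIntegralKernel S k) (y₀ : Eucl ν) (r : ℝ) :
    S (ballL2 y₀ r) =ᵐ[volume] fun x => ∫ y in Metric.closedBall y₀ r, k x y := by
  refine (hk.apply_ae_eq _).trans (Eventually.of_forall fun x => ?_)
  exact integral_mul_ballL2 _ _ _

theorem semigroup_ballL2_nonneg (hV : Continuous V) {M : ℝ} (hM : ∀ x, |V x| ≤ M)
    (hT : IsSemigroupGeneratedBy (-schrodinger V) T)
    (hK : ∀ t, 0 < t → IsIntegralKernel (T t) (K t)) {t : ℝ} (ht : 0 < t) (y₀ : Eucl ν) (r : ℝ) :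
    ∀ᵐ x, 0 ≤ T t (ballL2 y₀ r) x :=
  semigroup_nonneg hV hM hT (ballL2_nonneg y₀ r) (fun t ht =>
    ⟨_, continuous_setIntegral_closedBall (hK t ht).continuous y₀ r,
      apply_ballL2_ae_eq (hK t ht) y₀ r⟩) ht

theorem kernel_nonneg (hV : Continuous V) {M : ℝ} (hM : ∀ x, |V x| ≤ M)
    (hT : IsSemigroupGeneratedBy (-schrodinger V) T)
    (hK : ∀ t, 0 < t → IsIntegralKernel (T t) (K t)) {t : ℝ} (ht : 0 < t) (x y : Eucl ν) :
    0 ≤ K t x y := by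
  apply kernel_nonneg_of_setIntegral (hK t ht).continuous
  intro y₀ r hr
  filter_upwards [semigroup_ballL2_nonneg hV hM hT hK ht y₀ r,
    apply_ballL2_ae_eq (hK t ht) y₀ r] with x h1 h2
  rwa [h2] at h1

/-- The Gaussian upper bound. By positivity, the integrand of Duhamel's formula with `c = -M` is
nonpositive. -/
theorem kernel_le (hV : Continuous V) {M : ℝ} (hM : ∀ x, |V x| ≤ M)
    (hT : IsSemigroupGeneratedBy (-schrodinger V) T)
    (hK : ∀ t, 0 < t → IsIntegralKernel (T t) (K t)) {t : ℝ} (ht : 0 < t) (x y : Eucl ν) :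
    K t x y ≤ Real.exp (M * t) * gaussHeat t (x - y) := by
  have hp := continuous_gaussHeat (ν := ν) t
  have hcont : Continuous fun p : Eucl ν × Eucl ν =>
      Real.exp (M * t) * gaussHeat t (p.1 - p.2) - K t p.1 p.2 :=
    Continuous.sub (by fun_prop) (hK t ht).continuous
  have key := kernel_nonneg_of_setIntegral
    (k := fun x y => Real.exp (M * t) * gaussHeat t (x - y) - K t x y) hcont ?_ x y
  · linarith
  intro y₀ r hr
  filter_upwards with x
  have hKx : Continuous fun y => K t x y := (hK t ht).continuous.comp (Continuous.prodMk_right x)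
  have hpx : Continuous fun y => Real.exp (M * t) * gaussHeat t (x - y) := by fun_prop
  rw [integral_sub (hpx.continuousOn.integrableOn_compact (isCompact_closedBall _ _))
    (hKx.continuousOn.integrableOn_compact (isCompact_closedBall _ _)), integral_const_mul,
    sub_nonneg]
  have hle : ∀ᶠ ε : ℝ in 𝓝[>] 0, Real.exp (-M * t) * inner ℝ (gaussL2 ε x) (T t (ballL2 y₀ r)) ≤
      inner ℝ (gaussL2 (t + ε) x) (ballL2 y₀ r) := by
    filter_upwards [self_mem_nhdsWithin] with ε (hε : 0 < ε)
    rw [duhamel_L2 hV hM hT (ballL2 y₀ r) (-M) ht.le hε x]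
    have hneg : ∫ s in (0 : ℝ)..t, Real.exp (-M * s) * inner ℝ (gaussL2 (t - s + ε) x)
        (-M • T s (ballL2 y₀ r) - mulBounded hV hM (T s (ballL2 y₀ r))) ≤ 0 := by
      rw [intervalIntegral.integral_of_le ht.le]
      apply setIntegral_nonpos measurableSet_Ioc
      intro s hs
      have hpos : 0 < t - s + ε := by linarith [hs.2]
      apply mul_nonpos_of_nonneg_of_nonpos (Real.exp_pos _).le
      rw [← neg_nonneg, ← inner_neg_right]
      apply inner_gaussL2_nonneg hpos
      set w := T s (ballL2 y₀ r) with hw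
      filter_upwards [semigroup_ballL2_nonneg hV hM hT hK hs.1 y₀ r,
        Lp.coeFn_neg (-M • w - mulBounded hV hM w),
        Lp.coeFn_sub (-M • w) (mulBounded hV hM w), Lp.coeFn_smul (-M) w,
        coeFn_mulBounded hV hM w] with y h0 h1 h2 h3 h4
      rw [h1, Pi.neg_apply, h2, Pi.sub_apply, h3, h4, Pi.smul_apply, smul_eq_mul]
      have hVy := abs_le.1 (hM y)
      nlinarith
    linarith
  have hl1 := (tendsto_inner_gaussL2 (apply_ballL2_ae_eq (hK t ht) y₀ r)
    (continuous_setIntegral_closedBall (hK t ht).continuous y₀ r) x).const_mul (Real.exp (-M * t))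
  have hl2 : Tendsto (fun ε : ℝ => inner ℝ (gaussL2 (t + ε) x) (ballL2 y₀ r)) (𝓝[>] 0)
      (𝓝 (inner ℝ (gaussL2 t x) (ballL2 y₀ r))) := by
    have h1 : ContinuousAt (fun p : ℝ × Eucl ν => gaussL2 p.1 p.2) (t + 0, x) :=
      continuousOn_gaussL2.continuousAt
        ((isOpen_lt continuous_const continuous_fst).mem_nhds (by simpa using ht))
    have h2 : ContinuousAt (fun ε : ℝ => gaussL2 (t + ε) x) 0 :=
      ContinuousAt.comp (f := fun ε : ℝ => (t + ε, x)) h1 (by fun_prop)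
    have h3 := (h2.inner (𝕜 := ℝ) (continuousAt_const (y := ballL2 y₀ r))).tendsto
    rw [add_zero] at h3
    exact h3.mono_left nhdsWithin_le_nhds
  have hfin := le_of_tendsto_of_tendsto hl1 hl2 hle
  rw [inner_gaussL2 ht, integral_mul_ballL2] at hfin
  have he : Real.exp (M * t) * Real.exp (-M * t) = 1 := by
    rw [← Real.exp_add]; simp
  calc ∫ y in Metric.closedBall y₀ r, K t x y
      = Real.exp (M * t) * (Real.exp (-M * t) * ∫ y in Metric.closedBall y₀ r, K t x y) := by
        rw [← mul_assoc, he, one_mul]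
    _ ≤ _ := by gcongr

end KernelBounds

/-! ### Gaussian averages of bounded functions -/

/-- The free heat flow `P_τ g = p_τ * g`. -/
noncomputable def gaussConv {ν : ℕ} (τ : ℝ) (g : Eucl ν → ℝ) (x : Eucl ν) : ℝ :=
  ∫ y, gaussHeat τ (x - y) * g y

section GaussConv

variable {ν : ℕ} {g : Eucl ν → ℝ} {B : ℝ}

theorem integrable_gaussHeat_mul {τ : ℝ} (hτ : 0 < τ) (hg : AEStronglyMeasurable g volume)
    (hB : ∀ y, |g y| ≤ B) (x : Eucl ν) : Integrable fun y => gaussHeat τ (x - y) * g y :=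
  (integrable_gaussHeat_sub hτ x).mul_bdd hg (Eventually.of_forall hB)

theorem abs_gaussConv_le {τ : ℝ} (hτ : 0 < τ) (hB : ∀ y, |g y| ≤ B) (x : Eucl ν) :
    |gaussConv τ g x| ≤ B := by
  have h : ‖∫ y, gaussHeat τ (x - y) * g y‖ ≤ ∫ y, gaussHeat τ (x - y) * B := by
    apply norm_integral_le_of_norm_le ((integrable_gaussHeat_sub hτ x).mul_const B)
    filter_upwards with y
    rw [norm_mul, Real.norm_of_nonneg (gaussHeat_pos hτ _).le]
    exact mul_le_mul_of_nonneg_left (hB y) (gaussHeat_pos hτ _).le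
  rwa [integral_mul_const, integral_gaussHeat_sub hτ, one_mul] at h

theorem tendsto_gaussConv_time {τ : ℝ} (hτ : 0 < τ) (hg : AEStronglyMeasurable g volume)
    (hB : ∀ y, |g y| ≤ B) (x : Eucl ν) :
    Tendsto (fun ε => gaussConv (τ + ε) g x) (𝓝[>] 0) (𝓝 (gaussConv τ g x)) := by
  obtain ⟨C, hC, hev⟩ := exists_eventually_gaussHeat_le hτ x
  have hcont : ContinuousAt (fun ε : ℝ => (τ + ε, x)) 0 := by fun_prop
  have htend : Tendsto (fun ε : ℝ => (τ + ε, x)) (𝓝[>] 0) (𝓝 (τ, x)) := by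
    have := hcont.tendsto
    rw [add_zero] at this
    exact this.mono_left nhdsWithin_le_nhds
  apply tendsto_integral_filter_of_dominated_convergence
    (fun y => C * gaussHeat (4 * τ) (x - y) * B)
  · filter_upwards [self_mem_nhdsWithin] with ε (hε : 0 < ε)
    exact (integrable_gaussHeat_mul (by positivity) hg hB x).aestronglyMeasurable
  · filter_upwards [htend.eventually hev] with ε hε
    filter_upwards with y
    rw [norm_mul, Real.norm_of_nonneg (gaussHeat_pos hε.1 _).le]
    have h1 := gaussHeat_pos (ν := ν) (τ := 4 * τ) (by positivity) (x - y)
    exact mul_le_mul (hε.2 y) (hB y) (norm_nonneg _) (by positivity)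
  · exact ((integrable_gaussHeat_sub (by positivity) x).const_mul C).mul_const B
  · filter_upwards with y
    exact ((tendsto_gaussHeat_sub hτ x y).comp htend).mul_const _

theorem tendsto_gaussConv_of_bounded {τ : ℝ} (hτ : 0 < τ) {G : ℕ → Eucl ν → ℝ}
    (hG : ∀ n, AEStronglyMeasurable (G n) volume) (hB : ∀ n y, |G n y| ≤ B)
    (hlim : ∀ y, Tendsto (fun n => G n y) atTop (𝓝 (g y))) (x : Eucl ν) :
    Tendsto (fun n => gaussConv τ (G n) x) atTop (𝓝 (gaussConv τ g x)) := by
  apply tendsto_integral_of_dominated_convergence (fun y => gaussHeat τ (x - y) * B)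
  · exact fun n => (integrable_gaussHeat_mul hτ (hG n) (hB n) x).aestronglyMeasurable
  · exact (integrable_gaussHeat_sub hτ x).mul_const B
  · intro n
    filter_upwards with y
    rw [norm_mul, Real.norm_of_nonneg (gaussHeat_pos hτ _).le]
    exact mul_le_mul_of_nonneg_left (hB n y) (gaussHeat_pos hτ _).le
  · filter_upwards with y
    exact (hlim y).const_mul _

/-- The free heat flow turns bounded functions into differentiable ones, with gradient of order
`τ^{-1/2}`; this bound is integrable near `τ = 0`. -/
theorem exists_hasFDerivAt_gaussConv {τ : ℝ} (hτ : 0 < τ) (hg : AEStronglyMeasurable g volume)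
    (hB : ∀ y, |g y| ≤ B) (x : Eucl ν) :
    ∃ L : Eucl ν →L[ℝ] ℝ, HasFDerivAt (gaussConv τ g) L x ∧
      ‖L‖ ≤ 2 ^ (ν / 2 : ℝ) * (√τ)⁻¹ * B := by
  obtain ⟨C, hC, h⟩ := exists_gaussHeat_sub_le ν (α := 2 * τ) (β := 2 * τ) (by positivity) le_rfl 1
  have hp := continuous_gaussHeat (ν := ν) τ
  have hbd : ∀ z y : Eucl ν, ‖g y • ((-(gaussHeat τ (z - y) / τ)) • innerSL ℝ (z - y))‖ ≤
      2 ^ (ν / 2 : ℝ) * (√τ)⁻¹ * gaussHeat (2 * τ) (z - y) * B := by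
    intro z y
    rw [norm_smul, mul_comm]
    refine mul_le_mul (norm_fderiv_gaussHeat_le hτ _) (hB y) (norm_nonneg _) ?_
    have := gaussHeat_pos (ν := ν) (τ := 2 * τ) (by positivity) (z - y)
    positivity
  refine ⟨∫ y, g y • ((-(gaussHeat τ (x - y) / τ)) • innerSL ℝ (x - y)), ?_, ?_⟩
  · refine hasFDerivAt_integral_of_dominated_of_fderiv_le (s := Metric.ball x 1)
      (F := fun z y => gaussHeat τ (z - y) * g y)
      (F' := fun z y => g y • ((-(gaussHeat τ (z - y) / τ)) • innerSL ℝ (z - y)))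
      (bound := fun y => 2 ^ (ν / 2 : ℝ) * (√τ)⁻¹ * (C * gaussHeat (2 * (2 * τ)) (x - y)) * B)
      (Metric.ball_mem_nhds x one_pos) ?_ (integrable_gaussHeat_mul hτ hg hB x) ?_ ?_ ?_ ?_
    · exact Eventually.of_forall fun z =>
        (integrable_gaussHeat_mul hτ hg hB z).aestronglyMeasurable
    · exact hg.smul (Continuous.aestronglyMeasurable (by fun_prop))
    · filter_upwards with y z hz
      refine (hbd z y).trans ?_
      have hB0 : 0 ≤ B := (abs_nonneg _).trans (hB 0)
      have hz' : ‖z - x‖ ≤ 1 := by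
        rw [← dist_eq_norm]; exact (Metric.mem_ball.1 hz).le
      have := h (2 * τ) le_rfl le_rfl x z y hz'
      gcongr
    · exact (((integrable_gaussHeat_sub (by positivity) x).const_mul C).const_mul _).mul_const B
    · filter_upwards with y z _
      have h1 := (hasFDerivAt_gaussHeat τ (z - y)).comp z ((hasFDerivAt_id z).sub_const y)
      exact HasFDerivAt.mul_const (c := fun z => gaussHeat τ (z - y)) h1 (g y)
  · have hi := integrable_gaussHeat_sub (τ := 2 * τ) (by positivity) x
    refine (norm_integral_le_of_norm_le ((hi.const_mul _).mul_const B)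
      (Eventually.of_forall (hbd x))).trans ?_
    rw [integral_mul_const, integral_const_mul, integral_gaussHeat_sub (by positivity), mul_one]

end GaussConv

/-- The derivative at a point of a family of functions depends measurably on the parameter. -/
theorem aestronglyMeasurable_hasFDerivAt {ν : ℕ} {α : Type*} [MeasurableSpace α] {μ : Measure α}
    {F : Eucl ν → α → ℝ} {L : α → Eucl ν →L[ℝ] ℝ} {x : Eucl ν}
    (hF : ∀ z, AEStronglyMeasurable (F z) μ) (hL : ∀ᵐ a ∂μ, HasFDerivAt (F · a) (L a) x) :
    AEStronglyMeasurable L μ := by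
  have hv : ∀ v : Eucl ν, AEStronglyMeasurable (fun a => L a v) μ := by
    intro v
    refine aestronglyMeasurable_of_tendsto_ae atTop
      (f := fun (n : ℕ) a => (n : ℝ) • (F (x + (n : ℝ)⁻¹ • v) a - F x a)) (fun n => ?_) ?_
    · exact ((hF _).sub (hF _)).const_smul (n : ℝ)
    · filter_upwards [hL] with a ha
      have h := ha.lim_real v
      exact h.comp tendsto_natCast_atTop_atTop
  have e : L = fun a => ∑ i, L a (EuclideanSpace.basisFun (Fin ν) ℝ i) •
      innerSL ℝ (EuclideanSpace.basisFun (Fin ν) ℝ i) := by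
    ext a w
    conv_lhs => rw [← (EuclideanSpace.basisFun (Fin ν) ℝ).sum_repr' w]
    simp [mul_comm]
  rw [e]
  refine Finset.aestronglyMeasurable_fun_sum _ fun i _ => ?_
  exact (hv _).smul_const _

/-! ### The perturbed flow on bounded functions -/

section BoundedFlow

variable {ν : ℕ} {V : Eucl ν → ℝ} {T : ℝ → L2 ν →L[ℝ] L2 ν} {K : ℝ → Eucl ν → Eucl ν → ℝ}

theorem abs_kernel_le (hV : Continuous V) {M : ℝ} (hM : ∀ x, |V x| ≤ M)
    (hT : IsSemigroupGeneratedBy (-schrodinger V) T)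
    (hK : ∀ t, 0 < t → IsIntegralKernel (T t) (K t)) {t : ℝ} (ht : 0 < t) (x y : Eucl ν) :
    |K t x y| ≤ Real.exp (M * t) * gaussHeat t (x - y) := by
  rw [abs_of_nonneg (kernel_nonneg hV hM hT hK ht x y)]
  exact kernel_le hV hM hT hK ht x y

theorem continuous_kernel_right (hK : ∀ t, 0 < t → IsIntegralKernel (T t) (K t)) {t : ℝ}
    (ht : 0 < t) (x : Eucl ν) : Continuous (K t x) :=
  (hK t ht).continuous.comp (Continuous.prodMk_right x)

theorem continuous_kernel_left (hK : ∀ t, 0 < t → IsIntegralKernel (T t) (K t)) {t : ℝ}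
    (ht : 0 < t) (y : Eucl ν) : Continuous fun x => K t x y :=
  (hK t ht).continuous.comp (Continuous.prodMk_left y)

theorem norm_kernel_mul_le (hV : Continuous V) {M : ℝ} (hM : ∀ x, |V x| ≤ M)
    (hT : IsSemigroupGeneratedBy (-schrodinger V) T)
    (hK : ∀ t, 0 < t → IsIntegralKernel (T t) (K t)) {t : ℝ} (ht : 0 < t)
    {f : Eucl ν → ℝ} {B : ℝ} (hB : ∀ y, |f y| ≤ B) (x y : Eucl ν) :
    ‖K t x y * f y‖ ≤ Real.exp (M * t) * gaussHeat t (x - y) * B := by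
  rw [norm_mul]
  have h1 := abs_kernel_le hV hM hT hK ht x y
  exact mul_le_mul h1 (hB y) (norm_nonneg _) ((abs_nonneg _).trans h1)

theorem integrable_kernel_mul (hV : Continuous V) {M : ℝ} (hM : ∀ x, |V x| ≤ M)
    (hT : IsSemigroupGeneratedBy (-schrodinger V) T)
    (hK : ∀ t, 0 < t → IsIntegralKernel (T t) (K t)) {t : ℝ} (ht : 0 < t)
    {f : Eucl ν → ℝ} {B : ℝ} (hf : AEStronglyMeasurable f volume) (hB : ∀ y, |f y| ≤ B)
    (x : Eucl ν) : Integrable fun y => K t x y * f y := by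
  refine (((integrable_gaussHeat_sub ht x).const_mul (Real.exp (M * t))).mul_const B).mono'
    ((continuous_kernel_right hK ht x).aestronglyMeasurable.mul hf) ?_
  exact Eventually.of_forall (norm_kernel_mul_le hV hM hT hK ht hB x)

theorem abs_integral_kernel_mul_le (hV : Continuous V) {M : ℝ} (hM : ∀ x, |V x| ≤ M)
    (hT : IsSemigroupGeneratedBy (-schrodinger V) T)
    (hK : ∀ t, 0 < t → IsIntegralKernel (T t) (K t)) {t : ℝ} (ht : 0 < t)
    {f : Eucl ν → ℝ} {B : ℝ} (hB : ∀ y, |f y| ≤ B) (x : Eucl ν) :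
    |∫ y, K t x y * f y| ≤ Real.exp (M * t) * B := by
  have h := norm_integral_le_of_norm_le
    (((integrable_gaussHeat_sub ht x).const_mul (Real.exp (M * t))).mul_const B)
    (Eventually.of_forall (norm_kernel_mul_le hV hM hT hK ht hB x))
  rwa [integral_mul_const, integral_const_mul, integral_gaussHeat_sub ht, mul_one] at h

theorem continuous_integral_kernel_mul (hV : Continuous V) {M : ℝ} (hM : ∀ x, |V x| ≤ M)
    (hT : IsSemigroupGeneratedBy (-schrodinger V) T)
    (hK : ∀ t, 0 < t → IsIntegralKernel (T t) (K t)) {t : ℝ} (ht : 0 < t)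
    {f : Eucl ν → ℝ} {B : ℝ} (hf : AEStronglyMeasurable f volume) (hB : ∀ y, |f y| ≤ B) :
    Continuous fun x => ∫ y, K t x y * f y := by
  rw [continuous_iff_continuousAt]
  intro x₀
  obtain ⟨C, hC, h⟩ := exists_gaussHeat_sub_le ν (α := t) (β := t) ht le_rfl 1
  have hB0 : 0 ≤ B := (abs_nonneg _).trans (hB 0)
  apply continuousAt_of_dominated
    (bound := fun y => Real.exp (M * t) * (C * gaussHeat (2 * t) (x₀ - y)) * B)
  · exact Eventually.of_forall fun x =>
      (integrable_kernel_mul hV hM hT hK ht hf hB x).aestronglyMeasurable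
  · filter_upwards [Metric.ball_mem_nhds x₀ one_pos] with x hx
    filter_upwards with y
    refine (norm_kernel_mul_le hV hM hT hK ht hB x y).trans ?_
    have := h t le_rfl le_rfl x₀ x y (by rw [← dist_eq_norm]; exact (Metric.mem_ball.1 hx).le)
    gcongr
  · exact (((integrable_gaussHeat_sub (by positivity) x₀).const_mul C).const_mul _).mul_const B
  · filter_upwards with y
    exact ((continuous_kernel_left hK ht y).mul continuous_const).continuousAt

/-- The Chapman-Kolmogorov identity. -/
theorem kernel_chapman_kolmogorov (hV : Continuous V) {M : ℝ} (hM : ∀ x, |V x| ≤ M)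
    (hT : IsSemigroupGeneratedBy (-schrodinger V) T)
    (hK : ∀ t, 0 < t → IsIntegralKernel (T t) (K t)) {s t : ℝ} (hs : 0 < s) (ht : 0 < t)
    (x y : Eucl ν) : K (s + t) x y = ∫ z, K s x z * K t z y := by
  have hbt : ∀ z y, |K t z y| ≤ Real.exp (M * t) * (2 * Real.pi * t) ^ (-(ν / 2 : ℝ)) :=
    fun z y => (abs_kernel_le hV hM hT hK ht z y).trans (by gcongr; exact gaussHeat_le ht _)
  have hcont : Continuous fun p : Eucl ν × Eucl ν => ∫ z, K s p.1 z * K t z p.2 := by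
    rw [continuous_iff_continuousAt]
    rintro ⟨x₀, y₀⟩
    obtain ⟨C, hC, h⟩ := exists_gaussHeat_sub_le ν (α := s) (β := s) hs le_rfl 1
    apply continuousAt_of_dominated
      (bound := fun z => Real.exp (M * s) * (C * gaussHeat (2 * s) (x₀ - z)) *
        (Real.exp (M * t) * (2 * Real.pi * t) ^ (-(ν / 2 : ℝ))))
    · exact Eventually.of_forall fun p => (integrable_kernel_mul hV hM hT hK hs
        (continuous_kernel_left hK ht p.2).aestronglyMeasurable
          (fun z => hbt z p.2) p.1).aestronglyMeasurable
    · filter_upwards [(Metric.isOpen_ball.preimage continuous_fst).mem_nhds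
        (Metric.mem_ball_self one_pos : x₀ ∈ Metric.ball x₀ 1)] with p hp
      filter_upwards with z
      refine (norm_kernel_mul_le hV hM hT hK hs (fun z => hbt z p.2) p.1 z).trans ?_
      have := h s le_rfl le_rfl x₀ p.1 z (by rw [← dist_eq_norm]; exact (Metric.mem_ball.1 hp).le)
      gcongr
    · exact (((integrable_gaussHeat_sub (by positivity) x₀).const_mul C).const_mul _).mul_const _
    · filter_upwards with z
      exact (((continuous_kernel_left hK hs z).comp continuous_fst).mul
        ((continuous_kernel_right hK ht z).comp continuous_snd)).continuousAt
  apply kernel_eq_of_setIntegral (hK (s + t) (by positivity)).continuous hcont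
  intro y₀ r hr
  have e1 := apply_ballL2_ae_eq (hK (s + t) (by positivity)) y₀ r
  have e2 := (hK s hs).apply_ae_eq (T t (ballL2 y₀ r))
  have e3 := apply_ballL2_ae_eq (hK t ht) y₀ r
  rw [hT.add s t hs.le ht.le, ContinuousLinearMap.comp_apply] at e1
  filter_upwards [e1, e2] with x h1 h2
  rw [← h1, h2]
  have h3 : ∫ z, K s x z * (T t (ballL2 y₀ r)) z =
      ∫ z, ∫ y in Metric.closedBall y₀ r, K s x z * K t z y := by
    apply integral_congr_ae
    filter_upwards [e3] with z hz
    rw [hz, integral_const_mul]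
  rw [h3]
  apply integral_integral_swap
  have hdom : Integrable (fun p : Eucl ν × Eucl ν => Real.exp (M * s) * gaussHeat s (x - p.1) *
      (Real.exp (M * t) * (2 * Real.pi * t) ^ (-(ν / 2 : ℝ))))
      (volume.prod (volume.restrict (Metric.closedBall y₀ r))) := by
    have hc : Integrable (fun _ : Eucl ν => Real.exp (M * t) * (2 * Real.pi * t) ^ (-(ν / 2 : ℝ)))
        (volume.restrict (Metric.closedBall y₀ r)) :=
      continuous_const.continuousOn.integrableOn_compact (isCompact_closedBall _ _)
    exact ((integrable_gaussHeat_sub hs x).const_mul _).mul_prod hc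
  refine hdom.mono' ?_ (Eventually.of_forall fun p => ?_)
  · apply Continuous.aestronglyMeasurable
    exact ((continuous_kernel_right hK hs x).comp continuous_fst).mul (hK t ht).continuous
  · exact norm_kernel_mul_le hV hM hT hK hs (f := fun z => K t z p.2) (fun z => hbt z p.2) x p.1

theorem aestronglyMeasurable_mul_flow (hV : Continuous V) {M : ℝ} (hM : ∀ x, |V x| ≤ M)
    (hT : IsSemigroupGeneratedBy (-schrodinger V) T)
    (hK : ∀ t, 0 < t → IsIntegralKernel (T t) (K t)) {t : ℝ} (ht : 0 < t)
    {f : Eucl ν → ℝ} {B : ℝ} (hf : AEStronglyMeasurable f volume) (hB : ∀ y, |f y| ≤ B) :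
    AEStronglyMeasurable (fun z => V z * ∫ y, K t z y * f y) volume :=
  (hV.mul (continuous_integral_kernel_mul hV hM hT hK ht hf hB)).aestronglyMeasurable

theorem abs_mul_flow_le (hV : Continuous V) {M : ℝ} (hM : ∀ x, |V x| ≤ M)
    (hT : IsSemigroupGeneratedBy (-schrodinger V) T)
    (hK : ∀ t, 0 < t → IsIntegralKernel (T t) (K t)) {s t : ℝ} (hs : 0 < s) (hst : s ≤ t)
    {f : Eucl ν → ℝ} {B : ℝ} (hB : ∀ y, |f y| ≤ B) (z : Eucl ν) :
    |V z * ∫ y, K s z y * f y| ≤ M * (Real.exp (M * t) * B) := by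
  have hM0 : 0 ≤ M := (abs_nonneg _).trans (hM 0)
  have hB0 : 0 ≤ B := (abs_nonneg _).trans (hB 0)
  rw [abs_mul]
  refine mul_le_mul (hM z) ((abs_integral_kernel_mul_le hV hM hT hK hs hB z).trans ?_)
    (abs_nonneg _) hM0
  gcongr

theorem memLp_indicator_closedBall {f : Eucl ν → ℝ} {B : ℝ} (hf : AEStronglyMeasurable f volume)
    (hB : ∀ y, |f y| ≤ B) (R : ℝ) :
    MemLp ((Metric.closedBall (0 : Eucl ν) R).indicator f) 2 volume := by
  have hs := (Metric.isClosed_closedBall (x := (0 : Eucl ν)) (ε := R)).measurableSet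
  rw [memLp_indicator_iff_restrict hs]
  have : IsFiniteMeasure (volume.restrict (Metric.closedBall (0 : Eucl ν) R)) :=
    ⟨by simpa using measure_closedBall_lt_top⟩
  exact MemLp.of_bound hf.restrict B (Eventually.of_forall hB)

/-- Duhamel's formula in terms of the integral kernel, for `L²` data, mollified by `p_ε`. -/
theorem duhamel_kernel_L2 (hV : Continuous V) {M : ℝ} (hM : ∀ x, |V x| ≤ M)
    (hT : IsSemigroupGeneratedBy (-schrodinger V) T)
    (hK : ∀ t, 0 < t → IsIntegralKernel (T t) (K t)) {t : ℝ} (ht : 0 < t)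
    {f : Eucl ν → ℝ} (hf : MemLp f 2 volume) {ε : ℝ} (hε : 0 < ε) (x : Eucl ν) :
    AEStronglyMeasurable (fun s => gaussConv (t - s + ε) (fun z => V z * ∫ y, K s z y * f y) x)
      (volume.restrict (Ioo 0 t)) ∧
    gaussConv ε (fun z => ∫ y, K t z y * f y) x = gaussConv (t + ε) f x -
      ∫ s in Ioo 0 t, gaussConv (t - s + ε) (fun z => V z * ∫ y, K s z y * f y) x := by
  have hrep : ∀ s, 0 < s → T s hf.toLp =ᵐ[volume] fun z => ∫ y, K s z y * f y := by
    intro s hs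
    refine ((hK s hs).apply_ae_eq hf.toLp).trans (Eventually.of_forall fun z => ?_)
    apply integral_congr_ae
    filter_upwards [hf.coeFn_toLp] with y hy
    rw [hy]
  have hin : ∀ s ∈ Ioo 0 t, inner ℝ (gaussL2 (t - s + ε) x) (mulBounded hV hM (T s hf.toLp)) =
      gaussConv (t - s + ε) (fun z => V z * ∫ y, K s z y * f y) x := by
    intro s hs
    rw [inner_gaussL2_mulBounded hV hM (by linarith [hs.2])]
    apply integral_congr_ae
    filter_upwards [hrep s hs.1] with y hy
    rw [hy]
  constructor
  · have hc := (continuousOn_duhamel_integrand_time hT hf.toLp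
      (mulBounded hV hM).continuous t hε x).mono Ioo_subset_Icc_self
    refine (hc.aestronglyMeasurable (μ := volume) measurableSet_Ioo).congr ?_
    filter_upwards [self_mem_ae_restrict measurableSet_Ioo] with s hs using hin s hs
  · have hD := duhamel_L2 hV hM hT hf.toLp 0 ht.le hε x
    simp only [zero_mul, Real.exp_zero, one_mul, zero_smul, zero_sub, inner_neg_right] at hD
    rw [intervalIntegral.integral_neg, intervalIntegral.integral_of_le ht.le,
      integral_Ioc_eq_integral_Ioo, setIntegral_congr_fun measurableSet_Ioo hin,
      inner_gaussL2 hε, inner_gaussL2 (by linarith), ← sub_eq_add_neg] at hD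
    have e1 : ∫ y, gaussHeat ε (x - y) * T t hf.toLp y =
        gaussConv ε (fun z => ∫ y, K t z y * f y) x := by
      apply integral_congr_ae
      filter_upwards [hrep t ht] with y hy
      rw [hy]
    have e2 : ∫ y, gaussHeat (t + ε) (x - y) * (hf.toLp f) y = gaussConv (t + ε) f x := by
      apply integral_congr_ae
      filter_upwards [hf.coeFn_toLp] with y hy
      rw [hy]
    rwa [e1, e2] at hD

theorem tendsto_indicator_closedBall (f : Eucl ν → ℝ) (y : Eucl ν) :
    Tendsto (fun n : ℕ => (Metric.closedBall (0 : Eucl ν) n).indicator f y) atTop (𝓝 (f y)) := by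
  obtain ⟨N, hN⟩ := exists_nat_ge ‖y‖
  refine tendsto_const_nhds.congr' ?_
  filter_upwards [eventually_ge_atTop N] with n hn
  have : y ∈ Metric.closedBall (0 : Eucl ν) n := by
    rw [mem_closedBall_zero_iff]
    exact hN.trans (by exact_mod_cast hn)
  rw [indicator_of_mem this]

theorem abs_indicator_closedBall_le {f : Eucl ν → ℝ} {B : ℝ} (hB : ∀ y, |f y| ≤ B) (R : ℝ)
    (y : Eucl ν) : |(Metric.closedBall (0 : Eucl ν) R).indicator f y| ≤ B :=
  (norm_indicator_le_norm_self f y).trans (hB y)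

theorem tendsto_flow_indicator (hV : Continuous V) {M : ℝ} (hM : ∀ x, |V x| ≤ M)
    (hT : IsSemigroupGeneratedBy (-schrodinger V) T)
    (hK : ∀ t, 0 < t → IsIntegralKernel (T t) (K t)) {t : ℝ} (ht : 0 < t)
    {f : Eucl ν → ℝ} {B : ℝ} (hf : AEStronglyMeasurable f volume) (hB : ∀ y, |f y| ≤ B)
    (z : Eucl ν) :
    Tendsto (fun n : ℕ => ∫ y, K t z y * (Metric.closedBall (0 : Eucl ν) n).indicator f y) atTop
      (𝓝 (∫ y, K t z y * f y)) := by
  apply tendsto_integral_of_dominated_convergence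
    (fun y => Real.exp (M * t) * gaussHeat t (z - y) * B)
  · exact fun n => (integrable_kernel_mul hV hM hT hK ht
      (hf.indicator Metric.isClosed_closedBall.measurableSet)
        (abs_indicator_closedBall_le hB n) z).aestronglyMeasurable
  · exact ((integrable_gaussHeat_sub ht z).const_mul _).mul_const B
  · exact fun n => Eventually.of_forall
      (norm_kernel_mul_le hV hM hT hK ht (abs_indicator_closedBall_le hB n) z)
  · exact Eventually.of_forall fun y => (tendsto_indicator_closedBall f y).const_mul _

/-- Duhamel's formula for bounded data, mollified by `p_ε`. -/
theorem duhamel_mollified (hV : Continuous V) {M : ℝ} (hM : ∀ x, |V x| ≤ M)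
    (hT : IsSemigroupGeneratedBy (-schrodinger V) T)
    (hK : ∀ t, 0 < t → IsIntegralKernel (T t) (K t)) {t : ℝ} (ht : 0 < t)
    {f : Eucl ν → ℝ} {B : ℝ} (hf : AEStronglyMeasurable f volume) (hB : ∀ y, |f y| ≤ B)
    {ε : ℝ} (hε : 0 < ε) (x : Eucl ν) :
    AEStronglyMeasurable (fun s => gaussConv (t - s + ε) (fun z => V z * ∫ y, K s z y * f y) x)
      (volume.restrict (Ioo 0 t)) ∧
    gaussConv ε (fun z => ∫ y, K t z y * f y) x = gaussConv (t + ε) f x -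
      ∫ s in Ioo 0 t, gaussConv (t - s + ε) (fun z => V z * ∫ y, K s z y * f y) x := by
  set F : ℕ → Eucl ν → ℝ := fun n => (Metric.closedBall (0 : Eucl ν) n).indicator f with hF
  have hFm : ∀ n, AEStronglyMeasurable (F n) volume :=
    fun n => hf.indicator Metric.isClosed_closedBall.measurableSet
  have hFB : ∀ n y, |F n y| ≤ B := fun n => abs_indicator_closedBall_le hB n
  have hD := fun n : ℕ => duhamel_kernel_L2 hV hM hT hK ht (memLp_indicator_closedBall hf hB n) hε x
  have hlim : ∀ s ∈ Ioo 0 t, Tendsto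
      (fun n => gaussConv (t - s + ε) (fun z => V z * ∫ y, K s z y * F n y) x) atTop
      (𝓝 (gaussConv (t - s + ε) (fun z => V z * ∫ y, K s z y * f y) x)) := by
    intro s hs
    exact tendsto_gaussConv_of_bounded (by linarith [hs.2])
      (fun n => aestronglyMeasurable_mul_flow hV hM hT hK hs.1 (hFm n) (hFB n))
      (fun n => abs_mul_flow_le hV hM hT hK hs.1 hs.2.le (hFB n))
      (fun z => (tendsto_flow_indicator hV hM hT hK hs.1 hf hB z).const_mul _) x
  refine ⟨aestronglyMeasurable_of_tendsto_ae atTop (fun n => (hD n).1) ?_, ?_⟩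
  · filter_upwards [self_mem_ae_restrict measurableSet_Ioo] with s hs using hlim s hs
  · have l1 : Tendsto (fun n => gaussConv ε (fun z => ∫ y, K t z y * F n y) x) atTop
        (𝓝 (gaussConv ε (fun z => ∫ y, K t z y * f y) x)) :=
      tendsto_gaussConv_of_bounded hε
        (fun n => (continuous_integral_kernel_mul hV hM hT hK ht (hFm n)
          (hFB n)).aestronglyMeasurable)
        (fun n => abs_integral_kernel_mul_le hV hM hT hK ht (hFB n))
        (tendsto_flow_indicator hV hM hT hK ht hf hB) x
    have l2 : Tendsto (fun n => gaussConv (t + ε) (F n) x) atTop (𝓝 (gaussConv (t + ε) f x)) :=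
      tendsto_gaussConv_of_bounded (by positivity) hFm hFB (tendsto_indicator_closedBall f) x
    have l3 : Tendsto (fun n => ∫ s in Ioo 0 t,
        gaussConv (t - s + ε) (fun z => V z * ∫ y, K s z y * F n y) x) atTop
        (𝓝 (∫ s in Ioo 0 t, gaussConv (t - s + ε) (fun z => V z * ∫ y, K s z y * f y) x)) := by
      apply tendsto_integral_of_dominated_convergence (fun _ => M * (Real.exp (M * t) * B))
        (fun n => (hD n).1) (integrable_const _)
      · intro n
        filter_upwards [self_mem_ae_restrict measurableSet_Ioo] with s hs
        exact abs_gaussConv_le (by linarith [hs.2])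
          (abs_mul_flow_le hV hM hT hK hs.1 hs.2.le (hFB n)) x
      · filter_upwards [self_mem_ae_restrict measurableSet_Ioo] with s hs using hlim s hs
    exact tendsto_nhds_unique l1 ((l2.sub l3).congr fun n => (hD n).2.symm)

/-- Duhamel's formula for bounded data, pointwise. -/
theorem duhamel_bounded (hV : Continuous V) {M : ℝ} (hM : ∀ x, |V x| ≤ M)
    (hT : IsSemigroupGeneratedBy (-schrodinger V) T)
    (hK : ∀ t, 0 < t → IsIntegralKernel (T t) (K t)) {t : ℝ} (ht : 0 < t)
    {f : Eucl ν → ℝ} {B : ℝ} (hf : AEStronglyMeasurable f volume) (hB : ∀ y, |f y| ≤ B)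
    (x : Eucl ν) :
    AEStronglyMeasurable (fun s => gaussConv (t - s) (fun z => V z * ∫ y, K s z y * f y) x)
      (volume.restrict (Ioo 0 t)) ∧
    ∫ y, K t x y * f y = gaussConv t f x -
      ∫ s in Ioo 0 t, gaussConv (t - s) (fun z => V z * ∫ y, K s z y * f y) x := by
  have hD := fun (ε : ℝ) (hε : 0 < ε) => duhamel_mollified hV hM hT hK ht hf hB hε x
  have hlim : ∀ s ∈ Ioo 0 t, Tendsto
      (fun ε => gaussConv (t - s + ε) (fun z => V z * ∫ y, K s z y * f y) x) (𝓝[>] 0)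
      (𝓝 (gaussConv (t - s) (fun z => V z * ∫ y, K s z y * f y) x)) := by
    intro s hs
    exact tendsto_gaussConv_time (by linarith [hs.2])
      (aestronglyMeasurable_mul_flow hV hM hT hK hs.1 hf hB)
      (abs_mul_flow_le hV hM hT hK hs.1 hs.2.le hB) x
  have hmeas : ∀ᶠ ε : ℝ in 𝓝[>] 0, AEStronglyMeasurable
      (fun s => gaussConv (t - s + ε) (fun z => V z * ∫ y, K s z y * f y) x)
      (volume.restrict (Ioo 0 t)) := by
    filter_upwards [self_mem_nhdsWithin] with ε hε using (hD ε hε).1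
  constructor
  · have hεt : Tendsto (fun n : ℕ => 1 / ((n : ℝ) + 1)) atTop (𝓝[>] 0) :=
      tendsto_nhdsWithin_of_tendsto_nhds_of_eventually_within _
        tendsto_one_div_add_atTop_nhds_zero_nat
        (Eventually.of_forall fun n => by simp only [mem_Ioi]; positivity)
    refine aestronglyMeasurable_of_tendsto_ae atTop
      (fun n : ℕ => (hD (1 / ((n : ℝ) + 1)) (by positivity)).1) ?_
    filter_upwards [self_mem_ae_restrict measurableSet_Ioo] with s hs using (hlim s hs).comp hεt
  · have hu := continuous_integral_kernel_mul hV hM hT hK ht hf hB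
    have l1 : Tendsto (fun ε => gaussConv ε (fun z => ∫ y, K t z y * f y) x) (𝓝[>] 0)
        (𝓝 (∫ y, K t x y * f y)) :=
      tendsto_integral_gaussHeat_mul (g := fun z => ∫ y, K t z y * f y)
        (integrable_gaussHeat_mul one_pos hu.aestronglyMeasurable
          (abs_integral_kernel_mul_le hV hM hT hK ht hB) x) hu.continuousAt
    have l2 := tendsto_gaussConv_time ht hf hB x
    have l3 : Tendsto (fun ε => ∫ s in Ioo 0 t,
        gaussConv (t - s + ε) (fun z => V z * ∫ y, K s z y * f y) x) (𝓝[>] 0)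
        (𝓝 (∫ s in Ioo 0 t, gaussConv (t - s) (fun z => V z * ∫ y, K s z y * f y) x)) := by
      apply tendsto_integral_filter_of_dominated_convergence
        (fun _ => M * (Real.exp (M * t) * B)) hmeas _ (integrable_const _)
      · filter_upwards [self_mem_ae_restrict measurableSet_Ioo] with s hs using hlim s hs
      · filter_upwards [self_mem_nhdsWithin] with ε (hε : 0 < ε)
        filter_upwards [self_mem_ae_restrict measurableSet_Ioo] with s hs
        exact abs_gaussConv_le (by linarith [hs.2])
          (abs_mul_flow_le hV hM hT hK hs.1 hs.2.le hB) x
    refine tendsto_nhds_unique l1 ((l2.sub l3).congr' ?_)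
    filter_upwards [self_mem_nhdsWithin] with ε hε using (hD ε hε).2.symm

/-- The flow of bounded data is differentiable in space: the gradient of the integrand of Duhamel's
formula is of order `(t - s)^{-1/2}`, which is integrable. -/
theorem differentiable_integral_kernel_mul (hV : Continuous V) {M : ℝ} (hM : ∀ x, |V x| ≤ M)
    (hT : IsSemigroupGeneratedBy (-schrodinger V) T)
    (hK : ∀ t, 0 < t → IsIntegralKernel (T t) (K t)) {t : ℝ} (ht : 0 < t)
    {f : Eucl ν → ℝ} {B : ℝ} (hf : AEStronglyMeasurable f volume) (hB : ∀ y, |f y| ≤ B) :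
    Differentiable ℝ fun x => ∫ y, K t x y * f y := by
  have hD := fun x => duhamel_bounded hV hM hT hK ht hf hB x
  rw [show (fun x => ∫ y, K t x y * f y) = fun x => gaussConv t f x -
      ∫ s in Ioo 0 t, gaussConv (t - s) (fun z => V z * ∫ y, K s z y * f y) x from
    funext fun x => (hD x).2]
  intro x
  obtain ⟨L₀, hL₀, -⟩ := exists_hasFDerivAt_gaussConv ht hf hB x
  refine hL₀.differentiableAt.sub ?_
  have hex : ∀ s ∈ Ioo 0 t, ∀ z,
      HasFDerivAt (fun z => gaussConv (t - s) (fun z => V z * ∫ y, K s z y * f y) z)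
        (fderiv ℝ (fun z => gaussConv (t - s) (fun z => V z * ∫ y, K s z y * f y) z) z) z ∧
      ‖fderiv ℝ (fun z => gaussConv (t - s) (fun z => V z * ∫ y, K s z y * f y) z) z‖ ≤
        2 ^ (ν / 2 : ℝ) * (√(t - s))⁻¹ * (M * (Real.exp (M * t) * B)) := by
    intro s hs z
    obtain ⟨L, hL, hLb⟩ := exists_hasFDerivAt_gaussConv (τ := t - s) (by linarith [hs.2])
      (aestronglyMeasurable_mul_flow hV hM hT hK hs.1 hf hB)
      (abs_mul_flow_le hV hM hT hK hs.1 hs.2.le hB) z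
    have e : fderiv ℝ (fun z => gaussConv (t - s) (fun z => V z * ∫ y, K s z y * f y) z) z = L :=
      hL.fderiv
    rw [e]
    exact ⟨hL, hLb⟩
  have hsqrt : IntegrableOn (fun s : ℝ => (√(t - s))⁻¹) (Ioo 0 t) := by
    have h1 : IntervalIntegrable (fun s : ℝ => s ^ (-(1 / 2) : ℝ)) volume t 0 :=
      intervalIntegral.intervalIntegrable_rpow' (by norm_num)
    have h2 := h1.comp_sub_left t
    rw [sub_self, sub_zero, intervalIntegrable_iff_integrableOn_Ioo_of_le ht.le] at h2
    refine h2.congr_fun (fun s hs => ?_) measurableSet_Ioo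
    simp only
    rw [Real.rpow_neg (by linarith [hs.2]), ← Real.sqrt_eq_rpow]
  refine (hasFDerivAt_integral_of_dominated_of_fderiv_le (s := univ)
    (bound := fun s => 2 ^ (ν / 2 : ℝ) * (√(t - s))⁻¹ * (M * (Real.exp (M * t) * B)))
    (F' := fun z s => fderiv ℝ
      (fun z => gaussConv (t - s) (fun z => V z * ∫ y, K s z y * f y) z) z)
    univ_mem (Eventually.of_forall fun z => (hD z).1) ?_ ?_ ?_ ?_ ?_).differentiableAt
  · refine (integrable_const (M * (Real.exp (M * t) * B))).mono' (hD x).1 ?_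
    filter_upwards [self_mem_ae_restrict measurableSet_Ioo] with s hs
    exact abs_gaussConv_le (by linarith [hs.2]) (abs_mul_flow_le hV hM hT hK hs.1 hs.2.le hB) x
  · apply aestronglyMeasurable_hasFDerivAt (x := x) fun z => (hD z).1
    filter_upwards [self_mem_ae_restrict measurableSet_Ioo] with s hs using (hex s hs x).1
  · filter_upwards [self_mem_ae_restrict measurableSet_Ioo] with s hs z _ using (hex s hs z).2
  · exact (hsqrt.const_mul _).mul_const _
  · filter_upwards [self_mem_ae_restrict measurableSet_Ioo] with s hs z _ using (hex s hs z).1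

theorem differentiable_kernel_left (hV : Continuous V) {M : ℝ} (hM : ∀ x, |V x| ≤ M)
    (hT : IsSemigroupGeneratedBy (-schrodinger V) T)
    (hK : ∀ t, 0 < t → IsIntegralKernel (T t) (K t)) {t : ℝ} (ht : 0 < t) (y : Eucl ν) :
    Differentiable ℝ fun x => K t x y := by
  have ht2 : 0 < t / 2 := by positivity
  have e : (fun x => K t x y) = fun x => ∫ z, K (t / 2) x z * K (t / 2) z y := by
    ext x
    rw [← kernel_chapman_kolmogorov hV hM hT hK ht2 ht2, add_halves]
  rw [e]
  exact differentiable_integral_kernel_mul hV hM hT hK ht2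
    (continuous_kernel_left hK ht2 y).aestronglyMeasurable
    (fun z => (abs_kernel_le hV hM hT hK ht2 z y).trans
      (mul_le_mul_of_nonneg_left (gaussHeat_le ht2 _) (Real.exp_pos _).le))

end BoundedFlow

/-! ### Existence of the semigroup and of its kernel -/

section Existence

variable {ν : ℕ} {V Ω : Eucl ν → ℝ}

theorem integralKernel_zero (ν : ℕ) :
    integralKernel (0 : L2 ν →L[ℝ] L2 ν) = fun _ _ => 0 := by
  have h0 : IsIntegralKernel (0 : L2 ν →L[ℝ] L2 ν) (fun _ _ => 0) := by
    refine ⟨by fun_prop, fun f => ?_⟩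
    simp only [zero_mul, integral_zero]
    exact Lp.coeFn_zero ℝ 2 (volume : Measure (Eucl ν))
  have hex : ∃ k, IsIntegralKernel (0 : L2 ν →L[ℝ] L2 ν) k := ⟨_, h0⟩
  have hk := hex.choose_spec
  rw [integralKernel, dif_pos hex]
  ext x y
  refine kernel_eq_of_setIntegral (l := fun _ _ => 0) hk.continuous h0.continuous
    (fun y₀ r _ => ?_) x y
  exact (apply_ballL2_ae_eq hk y₀ r).symm.trans (apply_ballL2_ae_eq h0 y₀ r)

/-- The continuous kernel of `e^{-tH}` exists, since otherwise `heatKernel` would be the fallback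
value `0` and `e^{-tH} Ω` would vanish. -/
theorem isIntegralKernel_heatKernel (hΩ0 : Ω 0 ≠ 0)
    (hΩ : ∀ t : ℝ, 0 < t → ∀ x, heatFlow V Ω t x = Ω x) {t : ℝ} (ht : 0 < t) :
    IsIntegralKernel (expSemigroup (-schrodinger V) t) (heatKernel V t) := by
  by_cases hex : ∃ k, IsIntegralKernel (expSemigroup (-schrodinger V) t) k
  · rw [heatKernel, integralKernel, dif_pos hex]
    exact hex.choose_spec
  · refine absurd ?_ hΩ0
    rw [← hΩ t ht 0, heatFlow, heatKernel, integralKernel, dif_neg hex]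
    simp

/-- The semigroup `e^{-tH}` exists: the fallback value `0` of `expSemigroup` has the kernel `0`,
which is incompatible with `e^{-tH} Ω = Ω ≠ 0`. -/
theorem isSemigroupGeneratedBy_expSemigroup (hΩ0 : Ω 0 ≠ 0)
    (hΩ : ∀ t : ℝ, 0 < t → ∀ x, heatFlow V Ω t x = Ω x) :
    IsSemigroupGeneratedBy (-schrodinger V) (expSemigroup (-schrodinger V)) := by
  by_cases hex : ∃ T, IsSemigroupGeneratedBy (-schrodinger V) T
  · rw [expSemigroup, dif_pos hex]
    exact hex.choose_spec
  · refine absurd ?_ hΩ0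
    rw [← hΩ 1 one_pos 0, heatFlow, heatKernel, expSemigroup, dif_neg hex, Pi.zero_apply,
      integralKernel_zero]
    simp

end Existence

/-! ### Admissible initial data -/

theorem continuous_linePotential {ν : ℕ} {u₀ : Eucl ν → Eucl ν} (hu : Continuous u₀) :
    Continuous (linePotential u₀) := by
  apply intervalIntegral.continuous_parametric_intervalIntegral_of_continuous'
    (f := fun x s => inner ℝ (u₀ (s • x)) x)
  simp only [Function.uncurry_def]
  fun_prop

theorem IsAdmissible.exists_coleHopf_le {ν : ℕ} {u₀ : Eucl ν → Eucl ν} (hu : IsAdmissible u₀) :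
    ∃ B : ℝ, ∀ x, |coleHopf u₀ x| ≤ B := by
  obtain ⟨C, hC⟩ := hu.bounded
  refine ⟨Real.exp C, fun x => ?_⟩
  rw [coleHopf, abs_of_pos (Real.exp_pos _), Real.exp_le_exp]
  linarith [(abs_le.1 (hC x)).1]

theorem IsAdmissible.measurable_coleHopf {ν : ℕ} {u₀ : Eucl ν → Eucl ν} (hu : IsAdmissible u₀) :
    Measurable (coleHopf u₀) :=
  (Real.continuous_exp.comp (continuous_linePotential hu.continuous).neg).measurable

/-! ### From the kernel gradient to the gradient of the flow -/

/-- The mean value inequality along a segment. No integrability of the gradient is needed: if it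
fails, the right-hand side is infinite unless `v = 0`. -/
theorem enorm_sub_le_lintegral_fderiv {E : Type*} [NormedAddCommGroup E] [NormedSpace ℝ E]
    {g : E → ℝ} (hg : Differentiable ℝ g) (x v : E) :
    ‖g (x + v) - g x‖ₑ ≤ (∫⁻ s in Ioc (0 : ℝ) 1, ‖fderiv ℝ g (x + s • v)‖ₑ) * ‖v‖ₑ := by
  rw [← lintegral_mul_const' _ _ enorm_ne_top]
  have hd : ∀ s : ℝ, HasDerivAt (fun s : ℝ => g (x + s • v)) (fderiv ℝ g (x + s • v) v) s := by
    intro s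
    have h1 : HasDerivAt (fun s : ℝ => x + s • v) v s := by
      simpa using ((hasDerivAt_id s).smul_const v).const_add x
    exact (hg (x + s • v)).hasFDerivAt.comp_hasDerivAt s h1
  have hle : ∫⁻ s in Ioc (0 : ℝ) 1, ‖fderiv ℝ g (x + s • v) v‖ₑ ≤
      ∫⁻ s in Ioc (0 : ℝ) 1, ‖fderiv ℝ g (x + s • v)‖ₑ * ‖v‖ₑ :=
    lintegral_mono fun s => (fderiv ℝ g (x + s • v)).le_opENorm v
  refine le_trans ?_ hle
  by_cases hfin : ∫⁻ s in Ioc (0 : ℝ) 1, ‖fderiv ℝ g (x + s • v) v‖ₑ = ⊤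
  · rw [hfin]; exact le_top
  have hderiv : (fun s : ℝ => fderiv ℝ g (x + s • v) v) = deriv fun s : ℝ => g (x + s • v) :=
    funext fun s => (hd s).deriv.symm
  have hint : IntervalIntegrable (fun s : ℝ => fderiv ℝ g (x + s • v) v) volume 0 1 := by
    rw [intervalIntegrable_iff_integrableOn_Ioc_of_le zero_le_one]
    refine ⟨?_, lt_top_iff_ne_top.2 hfin⟩
    rw [hderiv]
    exact (measurable_deriv _).aestronglyMeasurable
  have h := intervalIntegral.integral_eq_sub_of_hasDerivAt (fun s _ => hd s) hint
  simp only [one_smul, zero_smul, add_zero] at h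
  rw [← h, intervalIntegral.integral_of_le zero_le_one]
  exact enorm_integral_le_lintegral_enorm _

/-- If the integrals `∫ ‖∂ₓ L(x, y)‖ dy` are bounded by `A`, then integrating `L` against a function
bounded by `B` gives a function with gradient bounded by `B A`. -/
theorem enorm_fderiv_integral_le {ν : ℕ} {L : Eucl ν → Eucl ν → ℝ} {h : Eucl ν → ℝ} {B : ℝ}
    (hLd : ∀ y, Differentiable ℝ fun x => L x y)
    (hLm : Measurable fun p : Eucl ν × Eucl ν => fderiv ℝ (fun z => L z p.1) p.2)
    (hB : ∀ y, |h y| ≤ B) (hint : ∀ x, Integrable fun y => L x y * h y) (x : Eucl ν) :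
    ‖fderiv ℝ (fun x => ∫ y, L x y * h y) x‖ₑ ≤
      ENNReal.ofReal B * ⨆ x, ∫⁻ y, ‖fderiv ℝ (fun z => L z y) x‖ₑ := by
  set A : ℝ≥0∞ := ⨆ x, ∫⁻ y, ‖fderiv ℝ (fun z => L z y) x‖ₑ with hA
  have hlip : ∀ x v : Eucl ν, ‖(∫ y, L (x + v) y * h y) - ∫ y, L x y * h y‖ₑ ≤
      ENNReal.ofReal B * A * ‖v‖ₑ := by
    intro x v
    rw [← integral_sub (hint _) (hint _)]
    calc ‖∫ y, L (x + v) y * h y - L x y * h y‖ₑ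
        ≤ ∫⁻ y, ‖L (x + v) y * h y - L x y * h y‖ₑ := enorm_integral_le_lintegral_enorm _
      _ ≤ ∫⁻ y, (ENNReal.ofReal B * ‖v‖ₑ) *
          ∫⁻ s in Ioc (0 : ℝ) 1, ‖fderiv ℝ (fun z => L z y) (x + s • v)‖ₑ := by
          apply lintegral_mono
          intro y
          simp only
          rw [← sub_mul, enorm_mul]
          have h1 := enorm_sub_le_lintegral_fderiv (hLd y) x v
          have h2 : ‖h y‖ₑ ≤ ENNReal.ofReal B := by
            rw [← ofReal_norm]
            exact ENNReal.ofReal_le_ofReal (hB y)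
          calc _ ≤ ((∫⁻ s in Ioc (0 : ℝ) 1, ‖fderiv ℝ (fun z => L z y) (x + s • v)‖ₑ) * ‖v‖ₑ) *
                ENNReal.ofReal B := mul_le_mul' h1 h2
            _ = _ := by ring
      _ = (ENNReal.ofReal B * ‖v‖ₑ) * ∫⁻ y,
          ∫⁻ s in Ioc (0 : ℝ) 1, ‖fderiv ℝ (fun z => L z y) (x + s • v)‖ₑ :=
          lintegral_const_mul' _ _ (ENNReal.mul_ne_top ENNReal.ofReal_ne_top enorm_ne_top)
      _ = (ENNReal.ofReal B * ‖v‖ₑ) * ∫⁻ s in Ioc (0 : ℝ) 1,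
          ∫⁻ y, ‖fderiv ℝ (fun z => L z y) (x + s • v)‖ₑ := by
          congr 1
          apply lintegral_lintegral_swap
          have hc : Continuous fun p : Eucl ν × ℝ => (p.1, x + p.2 • v) := by fun_prop
          exact (hLm.comp hc.measurable).enorm.aemeasurable
      _ ≤ (ENNReal.ofReal B * ‖v‖ₑ) * ∫⁻ _ in Ioc (0 : ℝ) 1, A := by
          gcongr with s
          exact le_iSup (fun x => ∫⁻ y, ‖fderiv ℝ (fun z => L z y) x‖ₑ) (x + s • v)
      _ = _ := by
          simp
          ring
  by_cases htop : ENNReal.ofReal B * A = ⊤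
  · rw [htop]; exact le_top
  have hnn : ‖fderiv ℝ (fun x => ∫ y, L x y * h y) x‖₊ ≤ (ENNReal.ofReal B * A).toNNReal := by
    refine norm_fderiv_le_of_lipschitz ℝ (C := (ENNReal.ofReal B * A).toNNReal) ?_
    intro z w
    rw [ENNReal.coe_toNNReal htop, edist_eq_enorm_sub, edist_eq_enorm_sub]
    have := hlip w (z - w)
    rwa [add_sub_cancel] at this
  rw [← ENNReal.coe_le_coe, ENNReal.coe_toNNReal htop] at hnn
  exact hnn

theorem proposition2p2 {ν : ℕ}
    (V : Eucl ν → ℝ) (hV : ContDiff ℝ 1 V) (hVb : ∃ C : ℝ, ∀ x, |V x| ≤ C)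
    (Ω : Eucl ν → ℝ) (hΩm : Measurable Ω)
    (a b : ℝ) (ha : 0 < a) (hΩa : ∀ x, a ≤ Ω x) (hΩb : ∀ x, Ω x ≤ b)
    (hΩ : ∀ t : ℝ, 0 < t → ∀ x, heatFlow V Ω t x = Ω x)
    (hL : Tendsto
      (fun t : ℝ => ⨆ x : Eucl ν, ∫⁻ y, ‖fderiv ℝ (fun z => intrinsicKernel V Ω t z y) x‖ₑ)
      atTop (𝓝 0))
    (u₀ : Eucl ν → Eucl ν) (hu₀ : IsAdmissible u₀) :
    (∀ t : ℝ, 0 < t → Differentiable ℝ fun x => heatFlow V (coleHopf u₀) t x / Ω x) ∧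
      Tendsto (fun t : ℝ => gradSupNorm fun x => heatFlow V (coleHopf u₀) t x / Ω x)
        atTop (𝓝 0) := by
  obtain ⟨M, hM⟩ := hVb
  have hVc : Continuous V := hV.continuous
  have hΩpos : ∀ x, 0 < Ω x := fun x => ha.trans_le (hΩa x)
  have hT := isSemigroupGeneratedBy_expSemigroup (hΩpos 0).ne' hΩ
  have hK : ∀ t, 0 < t →
      IsIntegralKernel (expSemigroup (-schrodinger V) t) (heatKernel V t) :=
    fun t ht => isIntegralKernel_heatKernel (hΩpos 0).ne' hΩ ht
  have hΩabs : ∀ x, |Ω x| ≤ b := fun x => by rw [abs_of_pos (hΩpos x)]; exact hΩb x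
  obtain ⟨B, hB⟩ := hu₀.exists_coleHopf_le
  have hφm := hu₀.measurable_coleHopf
  -- `Ω` is differentiable, being the flow of bounded data.
  have hΩd : Differentiable ℝ Ω := by
    have h := differentiable_integral_kernel_mul hVc hM hT hK one_pos
      hΩm.aestronglyMeasurable hΩabs
    rwa [show (fun x => ∫ y, heatKernel V 1 x y * Ω y) = Ω from funext (hΩ 1 one_pos)] at h
  have hflow : ∀ t, 0 < t → Differentiable ℝ fun x => heatFlow V (coleHopf u₀) t x :=
    fun t ht => differentiable_integral_kernel_mul hVc hM hT hK ht hφm.aestronglyMeasurable hB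
  refine ⟨fun t ht => ?_, ?_⟩
  · simp_rw [div_eq_mul_inv]
    exact (hflow t ht).mul (hΩd.fun_inv fun x => (hΩpos x).ne')
  have hbound : ∀ t, 0 < t →
      (gradSupNorm fun x => heatFlow V (coleHopf u₀) t x / Ω x) ≤ ENNReal.ofReal (b * B) *
        ⨆ x : Eucl ν, ∫⁻ y, ‖fderiv ℝ (fun z => intrinsicKernel V Ω t z y) x‖ₑ := by
    intro t ht
    have e1 : ∀ x y, intrinsicKernel V Ω t x y * (Ω y * coleHopf u₀ y) =
        (Ω x)⁻¹ * (heatKernel V t x y * coleHopf u₀ y) := by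
      intro x y
      have := (hΩpos y).ne'
      rw [intrinsicKernel]
      field_simp
    have e2 : (fun x => heatFlow V (coleHopf u₀) t x / Ω x) =
        fun x => ∫ y, intrinsicKernel V Ω t x y * (Ω y * coleHopf u₀ y) := by
      ext x
      simp_rw [e1]
      rw [integral_const_mul, heatFlow, div_eq_inv_mul]
    rw [gradSupNorm, e2]
    refine iSup_le fun x => enorm_fderiv_integral_le (fun y => ?_) ?_ (fun y => ?_) (fun x => ?_) x
    · exact ((hΩd.fun_inv fun x => (hΩpos x).ne').mul
        (differentiable_kernel_left hVc hM hT hK ht y)).mul_const _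
    · have hc : Continuous (Function.uncurry fun y z => intrinsicKernel V Ω t z y) := by
        have hΩi : Continuous fun x => (Ω x)⁻¹ := hΩd.continuous.inv₀ fun x => (hΩpos x).ne'
        exact ((hΩi.comp continuous_snd).mul ((hK t ht).continuous.comp continuous_swap)).mul
          (hΩi.comp continuous_fst)
      exact measurable_fderiv_with_param ℝ hc
    · rw [abs_mul]
      exact mul_le_mul (hΩabs y) (hB y) (abs_nonneg _) ((abs_nonneg _).trans (hΩabs y))
    · simp_rw [e1]
      exact (integrable_kernel_mul hVc hM hT hK ht hφm.aestronglyMeasurable hB x).const_mul _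
  have hlim := ENNReal.Tendsto.const_mul (a := ENNReal.ofReal (b * B)) hL
    (Or.inr ENNReal.ofReal_ne_top)
  rw [mul_zero] at hlim
  refine tendsto_of_tendsto_of_tendsto_of_le_of_le' tendsto_const_nhds hlim
    (Eventually.of_forall fun _ => zero_le) ?_
  filter_upwards [eventually_gt_atTop 0] with t ht using hbound t ht
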